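/- For a Borel measure $\mu$ supported on $[0,1]$ and $k\in\mathbb Z$ write $\widehat{\mu}(k)=\int_0^1 e^{-2\pi i k x}\,d\mu(x)$. **Theorem.** Let $C_1,C_2,B$ be real constants and let $2/3<\beta\le 1$. There is a constant $\epsilon_0>0$, depending only on $C_1,C_2,B,\beta$, such that the following holds. Let $0<\alpha<1$ with $\alpha>1-\epsilon_0$, and let $E\subset[0,1]$ be a closed set which supports a Borel probability measure $\mu$ (that is, $\mu(\mathbb R\setminus E)=0$) such that (A) $\mu([x,x+\epsilon])\le C_1\epsilon^{\alpha}$ for all $x\in\mathbb R$ and all $0<\epsilon\le 1$, (B) $|\widehat{\mu}(k)|\le C_2(1-\alpha)^{-B}|k|^{-\beta/2}$ for all integers $k\ne 0$. Then $E$ contains a non-trivial 3-term arithmetic progression, i.e. there are $x,r\in\mathbb R$ with $r\ne 0$ and $x,\ x+r,\ x+2r\in E$. -/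

import Mathlib

open MeasureTheory

/-- The Fourier coefficient `∫₀¹ e^{-2πikx} dμ(x)` of a measure `μ` supported on `[0,1]`. The
integral runs over the closed interval, so that both endpoints are included. -/
noncomputable def measureFourierCoeff (μ : Measure ℝ) (k : ℤ) : ℂ :=
  ∫ x in Set.Icc (0 : ℝ) 1, Complex.exp (-2 * Real.pi * Complex.I * k * x) ∂μ

/-!
Write `T = ℝ/ℤ` and, for `f : T → ℝ` and a weight `g`, consider the progression form
`Λ(f, g) = ∫∫ f(x) f(x+r) f(x+2r) g(r) dx dr`. The weight `stepWeight r = 1 - cos 2πr` vanishes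
only at `r = 0`, so it ignores trivial progressions, and it is a trigonometric polynomial with
frequencies `0, ±1`. For a measure `σ` on `T` let `f_h` (`tentSmoothing σ h`) be its convolution
with the tent of width `h` and mean one. The Fourier coefficients of `f_h` are those of `σ` damped by
Fejér-type multipliers in `[0, 1]` that tend to `1` as `h → 0`.

* Structure. The ball condition gives `f_h ≤ C h^(α-1)`, which is bounded by `6 C e` at the scale
  `h = exp(-1/(1-α))`. An averaged form of Roth's theorem
  (`exists_pos_le_progressionForm_stepWeight`) then bounds `Λ(f_h, stepWeight)` below by a constant
  that does not depend on `α`.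
* Randomness. On the Fourier side `Λ(f_h, e(m·)) = ∑_c a_c a_{c+m} a_{-(2c+m)}`, where `a` are
  the coefficients of `f_h`. As the coefficients of `σ` are at most `D |k|^(-β/2)` and `3β/2 > 1`,
  passing from scale `h` to any finer scale `h'` changes `Λ(·, stepWeight)` by at most
  `K D³ (h^γ + h'^γ)` with `γ = (3β/2 - 1)/2 > 0` (`progressionForm_stepWeight_sub_le`). Since `D`
  grows only polynomially in `1/(1-α)` while `h` is exponentially small, this loss is negligible
  for `α` close to `1`.
* Conclusion. Hence `Λ(f_{h'}, stepWeight)` stays bounded below as `h' → 0`. If the support of `σ`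
  had no non-trivial progression, then by compactness the progressions counted by `Λ(f_{h'}, ·)`
  would have steps tending to `0`, where `stepWeight` is small; as `Λ(f_{h'}, 1)` is bounded, this
  is a contradiction (`exists_progression_of_fourier_decay`).

A progression in `T` may wrap around. So `σ` is not the image of `μ` itself but its product with a
tent supported on a short arc that avoids `0` (`localize`); progressions in such an arc lift to `ℝ`
(`exists_real_progression`). The tent has absolutely summable Fourier coefficients, of size
`O(l⁻²)`, so the Fourier decay survives up to a constant. The arc carries a fixed proportion of the
mass because, by the ball condition, `μ` has little mass near `0` and `1`.
-/

open Filter Topology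

/-! ### The tent function and its Fourier series -/

/-- The tent of height and half-width `h` centred at `0` on the circle; `‖x‖` is the distance from
`x` to the nearest integer. It is not normalized: its integral is `h ^ 2` for `0 < h ≤ 1 / 2`. -/
noncomputable def tent (h : ℝ) (x : UnitAddCircle) : ℝ := max (h - ‖x‖) 0

/-- The `n`-th Fourier coefficient of `tent h`, valid for `0 < h ≤ 1 / 2`; it is real because the
tent is even. -/
noncomputable def tentCoeff (h : ℝ) (n : ℤ) : ℝ :=
  if n = 0 then h ^ 2 else (1 - Real.cos (2 * Real.pi * n * h)) / (2 * Real.pi ^ 2 * n ^ 2)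

lemma tent_nonneg (h : ℝ) (x : UnitAddCircle) : 0 ≤ tent h x := le_max_right _ _

lemma tent_le {h : ℝ} (hh : 0 ≤ h) (x : UnitAddCircle) : tent h x ≤ h :=
  max_le (by linarith [norm_nonneg x]) hh

lemma tent_eq_zero {h : ℝ} {x : UnitAddCircle} (hx : h ≤ ‖x‖) : tent h x = 0 :=
  max_eq_right (by linarith)

lemma continuous_tent (h : ℝ) : Continuous (tent h) := by
  unfold tent; fun_prop

lemma norm_coe_of_le_half {u : ℝ} (h0 : 0 ≤ u) (h1 : u ≤ 1 / 2) : ‖(u : UnitAddCircle)‖ = u := by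
  rw [(AddCircle.norm_coe_eq_abs_iff (1 : ℝ) one_ne_zero).2, abs_of_nonneg h0]
  rwa [abs_of_nonneg h0, abs_one]

lemma norm_coe_of_half_le {u : ℝ} (h0 : 1 / 2 ≤ u) (h1 : u ≤ 1) :
    ‖(u : UnitAddCircle)‖ = 1 - u := by
  have : ((1 - u : ℝ) : UnitAddCircle) = -(u : UnitAddCircle) := by
    rw [AddCircle.coe_sub, AddCircle.coe_period, zero_sub]
  rw [← norm_neg, ← this, norm_coe_of_le_half (by linarith) (by linarith)]

/-- The tent is an affine function of the second difference, with step `h`, of the periodic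
Bernoulli polynomial `B₂`. Here `u`, `v`, `z` represent `x`, `x + h`, `x - h` in `[0, 1]`. -/
lemma tent_eq_bernoulli {h : ℝ} (h0 : 0 < h) (h1 : h ≤ 1 / 2) (x : UnitAddCircle) :
    ∃ u ∈ Set.Icc (0 : ℝ) 1, ∃ v ∈ Set.Icc (0 : ℝ) 1, ∃ z ∈ Set.Icc (0 : ℝ) 1,
      (u : UnitAddCircle) = x ∧ (v : UnitAddCircle) = x + (h : ℝ) ∧
      (z : UnitAddCircle) = x - (h : ℝ) ∧
      tent h x = h ^ 2 - (bernoulliFun 2 v + bernoulliFun 2 z - 2 * bernoulliFun 2 u) / 2 := by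
  obtain ⟨u, hu, rfl⟩ := AddCircle.coe_image_Icc_eq (1 : ℝ) 0 ▸ Set.mem_univ x
  rw [zero_add] at hu
  have hv : ∃ v ∈ Set.Icc (0 : ℝ) 1, (v : UnitAddCircle) = (u : UnitAddCircle) + (h : ℝ) ∧
      ((v = u + h ∧ u ≤ 1 - h) ∨ (v = u + h - 1 ∧ 1 - h < u)) := by
    rcases le_or_gt u (1 - h) with H | H
    · exact ⟨u + h, ⟨by linarith [hu.1], by linarith⟩, by simp, .inl ⟨rfl, H⟩⟩
    · exact ⟨u + h - 1, ⟨by linarith, by linarith [hu.2]⟩,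
        by rw [AddCircle.coe_sub, AddCircle.coe_period, sub_zero, AddCircle.coe_add],
        .inr ⟨rfl, H⟩⟩
  have hz : ∃ z ∈ Set.Icc (0 : ℝ) 1, (z : UnitAddCircle) = (u : UnitAddCircle) - (h : ℝ) ∧
      ((z = u - h ∧ h ≤ u) ∨ (z = u - h + 1 ∧ u < h)) := by
    rcases le_or_gt h u with H | H
    · exact ⟨u - h, ⟨by linarith, by linarith [hu.2]⟩, by simp, .inl ⟨rfl, H⟩⟩
    · exact ⟨u - h + 1, ⟨by linarith [hu.1], by linarith⟩,
        by rw [AddCircle.coe_add, AddCircle.coe_period, add_zero, AddCircle.coe_sub],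
        .inr ⟨rfl, H⟩⟩
  obtain ⟨v, hv1, hv2, hv3⟩ := hv
  obtain ⟨z, hz1, hz2, hz3⟩ := hz
  refine ⟨u, hu, v, hv1, z, hz1, rfl, hv2, hz2, ?_⟩
  simp only [bernoulliFun_two, tent]
  obtain ⟨hu0, hu1⟩ := hu
  rcases le_total u (1 / 2) with H | H
  · rw [norm_coe_of_le_half hu0 H]
    rcases hv3 with ⟨rfl, a⟩ | ⟨rfl, a⟩ <;> rcases hz3 with ⟨rfl, b⟩ | ⟨rfl, b⟩ <;>
    first
    | (rw [max_eq_left (by linarith)]; ring1)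
    | (rw [max_eq_right (by linarith)]; ring1)
    | (exfalso; linarith)
  · rw [norm_coe_of_half_le H hu1]
    rcases hv3 with ⟨rfl, a⟩ | ⟨rfl, a⟩ <;> rcases hz3 with ⟨rfl, b⟩ | ⟨rfl, b⟩ <;>
    first
    | (rw [max_eq_left (by linarith)]; ring1)
    | (rw [max_eq_right (by linarith)]; ring1)
    | (exfalso; linarith)

/-- The Fourier series of the tent, read off from that of the Bernoulli polynomial `B₂`. -/
lemma hasSum_tent {h : ℝ} (h0 : 0 < h) (h1 : h ≤ 1 / 2) (x : UnitAddCircle) :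
    HasSum (fun n : ℤ => (tentCoeff h n : ℂ) * fourier n x) (tent h x : ℂ) := by
  obtain ⟨u, hu, v, hv, z, hz, hux, hvx, hzx, hT⟩ := tent_eq_bernoulli h0 h1 x
  have Hu := hasSum_one_div_pow_mul_fourier_mul_bernoulliFun (le_refl 2) hu
  have Hv := hasSum_one_div_pow_mul_fourier_mul_bernoulliFun (le_refl 2) hv
  have Hz := hasSum_one_div_pow_mul_fourier_mul_bernoulliFun (le_refl 2) hz
  have H0 : HasSum (fun n : ℤ => if n = 0 then (h : ℂ) ^ 2 else 0) ((h : ℂ) ^ 2) :=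
    hasSum_ite_eq 0 _
  have H := H0.sub (((Hv.add Hz).sub (Hu.mul_left 2)).mul_left (1 / (4 * Real.pi ^ 2) : ℂ))
  have hpi : (Real.pi : ℂ) ≠ 0 := by exact_mod_cast Real.pi_ne_zero
  have e1 : (fun n : ℤ => (tentCoeff h n : ℂ) * fourier n x) = fun n : ℤ =>
      (if n = 0 then (h : ℂ) ^ 2 else 0) - 1 / (4 * Real.pi ^ 2) *
        (1 / (n : ℂ) ^ 2 * fourier n (v : UnitAddCircle)
          + 1 / (n : ℂ) ^ 2 * fourier n (z : UnitAddCircle)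
          - 2 * (1 / (n : ℂ) ^ 2 * fourier n (u : UnitAddCircle))) := by
    funext n
    rw [hux, hvx, hzx, sub_eq_add_neg x]
    by_cases hn : n = 0
    · simp [hn, tentCoeff]
    · have hn' : (n : ℂ) ≠ 0 := by exact_mod_cast hn
      have e2 : fourier n (x + ((h : ℝ) : UnitAddCircle)) + fourier n (x + -((h : ℝ) : UnitAddCircle))
          = fourier n x * (2 * Real.cos (2 * Real.pi * n * h)) := by
        have : ∀ y : UnitAddCircle, fourier n (x + y) = fourier n x * fourier n y := by
          intro y; simp [fourier_apply, AddCircle.toCircle_add]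
        rw [this, this, ← mul_add, ← AddCircle.coe_neg, fourier_coe_apply, fourier_coe_apply]
        push_cast
        rw [Complex.two_cos]
        congr 3 <;> ring_nf
      simp only [tentCoeff, hn, if_false]
      push_cast at e2 ⊢
      linear_combination (exp := 1) (1 / (4 * Real.pi ^ 2 * n ^ 2) : ℂ) * e2
  have e3 : (tent h x : ℂ) = (h : ℂ) ^ 2 - 1 / (4 * Real.pi ^ 2) *
      (-(2 * Real.pi * Complex.I) ^ 2 / (Nat.factorial 2 : ℕ) * (bernoulliFun 2 v : ℂ)
        + -(2 * Real.pi * Complex.I) ^ 2 / (Nat.factorial 2 : ℕ) * (bernoulliFun 2 z : ℂ)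
        - 2 * (-(2 * Real.pi * Complex.I) ^ 2 / (Nat.factorial 2 : ℕ)
          * (bernoulliFun 2 u : ℂ))) := by
    rw [hT, mul_pow, Complex.I_sq]
    push_cast [Nat.factorial]
    field_simp
    ring
  rw [e1, e3]
  exact H

lemma tentCoeff_nonneg (h : ℝ) (n : ℤ) : 0 ≤ tentCoeff h n := by
  unfold tentCoeff
  split_ifs
  · positivity
  · exact div_nonneg (by linarith [Real.cos_le_one (2 * Real.pi * n * h)]) (by positivity)

lemma tentCoeff_le (h : ℝ) (n : ℤ) : tentCoeff h n ≤ h ^ 2 := by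
  unfold tentCoeff
  split_ifs with hn
  · rfl
  · have hn' : (n : ℝ) ≠ 0 := by exact_mod_cast hn
    rw [div_le_iff₀ (by positivity)]
    have := Real.one_sub_sq_div_two_le_cos (x := 2 * Real.pi * n * h)
    linarith

/-- The tent coefficients are close to the mean `h ^ 2` at frequencies below `1 / h`. The exponent
`γ` is free in `(0, 1]`: a small `γ` costs only a small power of `|n|` in later sums. -/
lemma sq_sub_tentCoeff_le {h : ℝ} (h0 : 0 < h) (n : ℤ) {γ : ℝ} (hγ : 0 < γ) (hγ1 : γ ≤ 1) :
    h ^ 2 - tentCoeff h n ≤ h ^ 2 * (2 * Real.pi * |(n : ℝ)| * h) ^ γ := by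
  by_cases hn : n = 0
  · simp [tentCoeff, hn, hγ.ne']
  have hn' : 0 < |(n : ℝ)| := by simpa using hn
  have hn2 : (n : ℝ) ≠ 0 := by simpa using hn
  set x := 2 * Real.pi * |(n : ℝ)| * h with hx
  have hx0 : 0 < x := by positivity
  -- For `x ≥ 1` the right side already exceeds `h ^ 2`; for `x ≤ 1` use the Taylor bound of `cos`.
  rcases le_total 1 x with H | H
  · have : 1 ≤ x ^ γ := Real.one_le_rpow H hγ.le
    nlinarith [tentCoeff_nonneg h n, sq_nonneg h]
  · have h2 : x ≤ x ^ γ := by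
      simpa using Real.rpow_le_rpow_of_exponent_ge hx0 H hγ1
    have h3 := Real.cos_bound (x := x) (by rwa [abs_of_pos hx0])
    have h4 : Real.cos (2 * Real.pi * n * h) = Real.cos x := by
      rw [← Real.cos_abs (2 * Real.pi * n * h)]
      simp [hx, abs_mul, abs_of_pos h0, abs_of_pos Real.pi_pos]
    have h5 : tentCoeff h n = h ^ 2 * (2 * (1 - Real.cos x) / x ^ 2) := by
      simp only [tentCoeff, hn, if_false]
      rw [h4, hx, mul_pow, mul_pow, sq_abs]
      field_simp
    have h6 : 1 - x ≤ 2 * (1 - Real.cos x) / x ^ 2 := by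
      rw [le_div_iff₀ (by positivity)]
      rw [abs_of_pos hx0] at h3
      have := (abs_le.1 h3).2
      have h7 : x ^ 4 ≤ x ^ 3 := pow_le_pow_of_le_one hx0.le H (by norm_num)
      have : (0 : ℝ) ≤ x ^ 3 := by positivity
      nlinarith
    rw [h5]
    nlinarith [sq_nonneg h]

lemma tentCoeff_le_one_div (h : ℝ) {n : ℤ} (hn : n ≠ 0) : tentCoeff h n ≤ 1 / (n : ℝ) ^ 2 := by
  simp only [tentCoeff, hn, if_false]
  have hn' : (n : ℝ) ≠ 0 := by exact_mod_cast hn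
  rw [div_le_div_iff₀ (by positivity) (by positivity)]
  have h1 := Real.neg_one_le_cos (2 * Real.pi * n * h)
  have h2 := Real.pi_gt_three
  have h3 : 0 < (n : ℝ) ^ 2 := by positivity
  have h4 : 1 - Real.cos (2 * Real.pi * n * h) ≤ 2 * Real.pi ^ 2 := by nlinarith
  calc _ ≤ 2 * Real.pi ^ 2 * (n : ℝ) ^ 2 := by gcongr
    _ = _ := by ring

/-! ### Fourier expansion of the progression form -/

instance UnitAddCircle.isProbabilityMeasure_volume :
    IsProbabilityMeasure (volume : Measure UnitAddCircle) := ⟨UnitAddCircle.measure_univ⟩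

lemma UnitAddCircle.integral_fourier (n : ℤ) :
    ∫ x : UnitAddCircle, fourier n x = if n = 0 then 1 else 0 := by
  split_ifs with h
  · simp [h]
  · exact integral_eq_zero_of_add_right_eq_neg (fourier_add_half_inv_index h one_pos)

lemma UnitAddCircle.integrable_of_continuous {E : Type*} [NormedAddCommGroup E]
    {f : UnitAddCircle → E} (hf : Continuous f) : Integrable f :=
  hf.integrable_of_hasCompactSupport (HasCompactSupport.of_compactSpace f)

lemma UnitAddCircle.integrable_prod_of_continuous {E : Type*} [NormedAddCommGroup E]
    {f : UnitAddCircle × UnitAddCircle → E} (hf : Continuous f) : Integrable f :=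
  hf.integrable_of_hasCompactSupport (HasCompactSupport.of_compactSpace f)

lemma fourier_apply_add (n : ℤ) (x y : UnitAddCircle) :
    fourier n (x + y) = fourier n x * fourier n y := by
  simp [fourier_apply, AddCircle.toCircle_add]

lemma norm_fourier_apply (n : ℤ) (x : UnitAddCircle) : ‖fourier n x‖ = 1 := by
  rw [fourier_apply]; exact Circle.norm_coe _

lemma integral_mul_fourier_of_hasSum {f : UnitAddCircle → ℂ} {a : ℤ → ℂ}
    (ha : Summable fun k => ‖a k‖) (hf : ∀ x, HasSum (fun k => a k * fourier k x) (f x))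
    (n : ℤ) : ∫ x, f x * fourier n x = a (-n) := by
  have h1 : ∀ k, ∫ x : UnitAddCircle, a k * fourier k x * fourier n x
      = if k = -n then a (-n) else 0 := by
    intro k
    simp_rw [mul_assoc, ← fourier_add]
    rw [integral_const_mul, UnitAddCircle.integral_fourier]
    rcases eq_or_ne k (-n) with rfl | h
    · simp
    · rw [if_neg h, if_neg (by lia), mul_zero]
  have h2 := hasSum_integral_of_summable_integral_norm
    (μ := (volume : Measure UnitAddCircle)) (F := fun (k : ℤ) x => a k * fourier k x * fourier n x)
    (fun k => UnitAddCircle.integrable_of_continuous (by fun_prop))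
    (by simpa [norm_fourier_apply, -fourier_apply] using ha)
  simp_rw [h1, tsum_mul_right, (hf _).tsum_eq] at h2
  exact h2.unique (hasSum_ite_eq _ _)

/-- The form `∫∫ f(x) f(x+r) f(x+2r) g(r) dx dr`, counting three-term progressions in the circle
with a weight `g` on the common difference. -/
noncomputable def progressionForm {𝕜 : Type*} [RCLike 𝕜] (f g : UnitAddCircle → 𝕜) : 𝕜 :=
  ∫ p : UnitAddCircle × UnitAddCircle, f p.1 * f (p.1 + p.2) * f (p.1 + p.2 + p.2) * g p.2

/-- For a weight equal to a character, the progression form is a sum over one frequency: expand only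
`f (x + 2r)`, and integrate first in `r`, then in `x`. -/
lemma hasSum_progressionForm_fourier {f : UnitAddCircle → ℂ} (hfc : Continuous f) {a : ℤ → ℂ}
    (ha : Summable fun k => ‖a k‖) (hf : ∀ x, HasSum (fun k => a k * fourier k x) (f x))
    (m : ℤ) :
    HasSum (fun c => a c * a (c + m) * a (-(2 * c + m))) (progressionForm f (fourier m)) := by
  let F : ℤ → UnitAddCircle × UnitAddCircle → ℂ := fun c p =>
    f p.1 * f (p.1 + p.2) * (a c * fourier c (p.1 + p.2 + p.2)) * fourier m p.2
  have hFc : ∀ c, Continuous (F c) := fun c => by simp only [F]; fun_prop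
  have hFi : ∀ c, Integrable (F c) := fun c =>
    UnitAddCircle.integrable_prod_of_continuous (hFc c)
  have hF : ∀ c, ∫ p, F c p = a c * a (c + m) * a (-(2 * c + m)) := by
    intro c
    rw [Measure.volume_eq_prod, integral_prod _ (by simpa [← Measure.volume_eq_prod] using hFi c)]
    have h1 : ∀ x, ∫ r, F c (x, r) = a c * a (-(2 * c + m)) * (f x * fourier (-(c + m)) x) := by
      intro x
      have h2 : ∀ r, F c (x, r) = a c * (f x * fourier (-(c + m)) x) *
          (fun s => f s * fourier (2 * c + m) s) (x + r) := by
        intro r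
        simp only [F, fourier_apply_add, fourier_add, neg_add, two_mul, fourier_neg]
        have hc : fourier c x * (starRingEnd ℂ) (fourier c x) = 1 := by
          rw [Complex.mul_conj, Complex.normSq_eq_norm_sq, norm_fourier_apply]; norm_num
        have hm : fourier m x * (starRingEnd ℂ) (fourier m x) = 1 := by
          rw [Complex.mul_conj, Complex.normSq_eq_norm_sq, norm_fourier_apply]; norm_num
        linear_combination (-(a c * f x * f (x + r) * fourier c x * fourier c r ^ 2 * fourier m r)) *
          (hc * fourier m x * (starRingEnd ℂ) (fourier m x)  + hm)
      simp_rw [h2]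
      rw [integral_const_mul, integral_add_left_eq_self (μ := (volume : Measure UnitAddCircle))
        (fun s => f s * fourier (2 * c + m) s), integral_mul_fourier_of_hasSum ha hf]
      ring
    simp_rw [h1]
    rw [integral_const_mul, integral_mul_fourier_of_hasSum ha hf, neg_neg]
    ring
  obtain ⟨M, hM⟩ : ∃ M, ∀ x, ‖f x‖ ≤ M := by
    obtain ⟨M, hM⟩ := isCompact_univ.exists_bound_of_continuousOn hfc.continuousOn
    exact ⟨M, fun x => hM x trivial⟩
  have hM0 : 0 ≤ M := (norm_nonneg _).trans (hM 0)
  have hS : Summable fun c => ∫ p, ‖F c p‖ := by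
    refine Summable.of_nonneg_of_le (fun c => integral_nonneg fun _ => norm_nonneg _)
      (fun c => ?_) (ha.mul_left (M * M))
    have : ∀ p, ‖F c p‖ ≤ M * M * ‖a c‖ := by
      intro p
      simp only [F, norm_mul, norm_fourier_apply, mul_one]
      gcongr <;> exact hM _
    calc _ ≤ ∫ p : UnitAddCircle × UnitAddCircle, M * M * ‖a c‖ :=
        integral_mono (hFi c).norm (integrable_const _) this
      _ = _ := by simp
  have h3 := hasSum_integral_of_summable_integral_norm hFi hS
  simp_rw [hF] at h3
  have h4 : progressionForm f (fourier m) = ∫ p, ∑' c, F c p := by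
    unfold progressionForm
    congr 1 with p
    simp only [F]
    rw [tsum_mul_right, tsum_mul_left, (hf _).tsum_eq]
  rw [h4]
  exact h3

/-! ### Roth's theorem for bounded functions on the circle -/

/-- Every non-trivial progression `a, b, c` of coefficients yields the same integral, because
`(x, r) ↦ (x + a r, (b - a) r)` preserves the measure of the torus. -/
lemma integral_three_term_progression {f : UnitAddCircle → ℝ} (hf : Continuous f) {a b c : ℕ}
    (habc : a + c = b + b) (hab : a ≠ b) :
    ∫ p : UnitAddCircle × UnitAddCircle,
      f (p.1 + a • p.2) * f (p.1 + b • p.2) * f (p.1 + c • p.2)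
      = progressionForm f fun _ => 1 := by
  set d : ℤ := (b : ℤ) - a with hd
  have hd0 : d ≠ 0 := by lia
  let Φ : UnitAddCircle → UnitAddCircle → ℝ := fun x r => f x * f (x + r) * f (x + r + r)
  have h1 : ∀ x r : UnitAddCircle, f (x + a • r) * f (x + b • r) * f (x + c • r)
      = Φ (x + a • r) (d • r) := by
    intro x r
    have e1 : x + b • r = x + a • r + d • r := by
      rw [hd, sub_zsmul, natCast_zsmul, natCast_zsmul]; abel
    have e2 : x + c • r = x + a • r + d • r + d • r := by
      have : (c : ℤ) = a + d + d := by lia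
      rw [← natCast_zsmul r c, this, add_zsmul, add_zsmul, natCast_zsmul]; abel
    simp only [Φ, e1, e2]
  have hi1 : Integrable (fun p : UnitAddCircle × UnitAddCircle =>
      f (p.1 + a • p.2) * f (p.1 + b • p.2) * f (p.1 + c • p.2)) (volume.prod volume) :=
    UnitAddCircle.integrable_prod_of_continuous (by fun_prop)
  have hi2 : Integrable (fun p : UnitAddCircle × UnitAddCircle => Φ p.1 p.2)
      (volume.prod volume) :=
    UnitAddCircle.integrable_prod_of_continuous (by simp only [Φ]; fun_prop)
  have h3 : ∀ r, ∫ x, Φ (x + a • r) (d • r) = ∫ x, Φ x (d • r) := fun r =>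
    integral_add_right_eq_self (μ := (volume : Measure UnitAddCircle)) (fun x => Φ x (d • r)) _
  have hmp := Measure.measurePreserving_zsmul (volume : Measure UnitAddCircle) hd0
  have h4 : ∫ r, ∫ x, Φ x (d • r) = ∫ r, ∫ x, Φ x r := by
    have := integral_map (μ := (volume : Measure UnitAddCircle)) (φ := fun r => d • r)
      (f := fun r => ∫ x, Φ x r) hmp.measurable.aemeasurable
      (by rw [hmp.map_eq]; exact hi2.integral_prod_right.aestronglyMeasurable)
    rw [← this, hmp.map_eq]
  unfold progressionForm
  rw [Measure.volume_eq_prod, integral_prod_symm _ hi1]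
  simp_rw [h1, h3]
  rw [h4, ← integral_prod_symm _ hi2]
  simp [Φ]

/-- Varnavides' averaging of Roth's theorem: restrict `f` to the random progressions
`x, x + r, …, x + (n - 1) r` with `n` fixed, and apply Roth's theorem to the places where `f` is
large. -/
lemma exists_pos_le_progressionForm_one {M m : ℝ} (hM : 0 < M) (hm : 0 < m) :
    ∃ c : ℝ, 0 < c ∧ ∀ f : UnitAddCircle → ℝ, Continuous f → (∀ x, 0 ≤ f x) → (∀ x, f x ≤ M) →
      m ≤ ∫ x, f x → c ≤ progressionForm f fun _ => 1 := by
  classical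
  obtain ⟨n, hn⟩ := exists_nat_ge (cornersTheoremBound (m / (4 * M) / 3) + 1 : ℝ)
  have hn1 : cornersTheoremBound (m / (4 * M) / 3) ≤ n := by
    have : (cornersTheoremBound (m / (4 * M) / 3) : ℝ) ≤ n := by linarith
    exact_mod_cast this
  have hn0 : (0 : ℝ) < n := by
    have : (0 : ℝ) ≤ cornersTheoremBound (m / (4 * M) / 3) := Nat.cast_nonneg _
    linarith
  let P : Finset (ℕ × ℕ × ℕ) := (Finset.range n ×ˢ Finset.range n ×ˢ Finset.range n).filter
    fun t => t.1 + t.2.2 = t.2.1 + t.2.1 ∧ t.1 ≠ t.2.1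
  set κ : ℝ := (m / 4) ^ 3 / M with hκ
  have hκ0 : 0 < κ := by positivity
  refine ⟨κ * (m / 2) / (P.card + 1), by positivity, fun f hf hf0 hfM hfm => ?_⟩
  let G : UnitAddCircle × UnitAddCircle → ℝ := fun p =>
    ∑ t ∈ P, f (p.1 + t.1 • p.2) * f (p.1 + t.2.1 • p.2) * f (p.1 + t.2.2 • p.2)
  have hG0 : ∀ p, 0 ≤ G p := fun p => Finset.sum_nonneg fun t _ =>
    mul_nonneg (mul_nonneg (hf0 _) (hf0 _)) (hf0 _)
  let A : UnitAddCircle × UnitAddCircle → ℝ := fun p =>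
    (∑ j ∈ Finset.range n, f (p.1 + j • p.2)) / n
  have hAM : ∀ p, A p ≤ M := fun p => by
    simp only [A]
    rw [div_le_iff₀ hn0]
    calc _ ≤ ∑ j ∈ Finset.range n, M := Finset.sum_le_sum fun j _ => hfM _
      _ = _ := by simp [mul_comm]
  -- If the average `A p` is at least `m / 2`, then `f ≥ m / 4` at a proportion `m / (4M)` of the
  -- points, so some progression contributes `(m / 4) ^ 3 = κ M`. Otherwise the left side is negative.
  have key : ∀ p, κ * (A p - m / 2) ≤ G p := by
    intro p
    rcases le_total (A p) (m / 2) with H | H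
    · exact (mul_nonpos_of_nonneg_of_nonpos hκ0.le (by linarith)).trans (hG0 p)
    let S : Finset ℕ := (Finset.range n).filter fun j => m / 4 ≤ f (p.1 + j • p.2)
    have hS : m / (4 * M) * n ≤ S.card := by
      have h1 : ∑ j ∈ Finset.range n, f (p.1 + j • p.2) ≤ S.card * M + n * (m / 4) := by
        rw [← Finset.sum_filter_add_sum_filter_not (Finset.range n)
          (fun j => m / 4 ≤ f (p.1 + j • p.2))]
        refine add_le_add ?_ ?_
        · refine (Finset.sum_le_card_nsmul _ _ M fun j _ => hfM _).trans ?_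
          simp [S]
        · refine (Finset.sum_le_card_nsmul _ _ (m / 4) fun j hj => ?_).trans ?_
          · exact (not_le.1 (Finset.mem_filter.1 hj).2).le
          · rw [nsmul_eq_mul]
            gcongr
            exact (Finset.card_filter_le _ _).trans (by simp)
      have h2 : m / 2 * n ≤ ∑ j ∈ Finset.range n, f (p.1 + j • p.2) := by
        rwa [le_div_iff₀ hn0] at H
      rw [div_mul_eq_mul_div, div_le_iff₀ (by positivity)]
      linarith
    have hR := roth_3ap_theorem_nat (m / (4 * M)) (by positivity) hn1 S
      (Finset.filter_subset _ _) hS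
    simp only [ThreeAPFree, not_forall] at hR
    obtain ⟨a, ha, b, hb, c, hc, habc, hab⟩ := hR
    simp only [S, Finset.coe_filter, Set.mem_ofPred_eq] at ha hb hc
    have hmem : (a, b, c) ∈ P := by
      simp only [P, Finset.mem_filter, Finset.mem_product]
      exact ⟨⟨ha.1, hb.1, hc.1⟩, habc, hab⟩
    calc κ * (A p - m / 2) ≤ κ * M := by
          gcongr
          linarith [hAM p]
      _ = m / 4 * (m / 4) * (m / 4) := by rw [hκ]; field_simp
      _ ≤ f (p.1 + a • p.2) * f (p.1 + b • p.2) * f (p.1 + c • p.2) := by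
          gcongr
          · exact mul_nonneg (hf0 _) (hf0 _)
          · exact hf0 _
          · exact ha.2
          · exact hb.2
          · exact hc.2
      _ ≤ G p := Finset.single_le_sum (f := fun t : ℕ × ℕ × ℕ =>
          f (p.1 + t.1 • p.2) * f (p.1 + t.2.1 • p.2) * f (p.1 + t.2.2 • p.2))
          (fun t _ => mul_nonneg (mul_nonneg (hf0 _) (hf0 _)) (hf0 _)) hmem
  have hGi : ∫ p, G p = P.card * progressionForm f fun _ => 1 := by
    simp only [G]
    rw [integral_finsetSum _ fun t _ =>
      UnitAddCircle.integrable_prod_of_continuous (by fun_prop)]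
    rw [Finset.sum_congr rfl fun t ht => integral_three_term_progression hf
      (Finset.mem_filter.1 ht).2.1 (Finset.mem_filter.1 ht).2.2]
    simp
  have hAi : ∫ p, A p = ∫ x, f x := by
    simp only [A]
    rw [integral_div, integral_finsetSum _ fun j _ =>
      UnitAddCircle.integrable_prod_of_continuous (by fun_prop)]
    have : ∀ j : ℕ, ∫ p : UnitAddCircle × UnitAddCircle, f (p.1 + j • p.2) = ∫ x, f x := by
      intro j
      rw [Measure.volume_eq_prod, integral_prod_symm _
        (UnitAddCircle.integrable_prod_of_continuous (by fun_prop))]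
      simp [integral_add_right_eq_self]
    simp [this, hn0.ne']
  have hint := integral_mono (μ := (volume : Measure (UnitAddCircle × UnitAddCircle)))
    (UnitAddCircle.integrable_prod_of_continuous (by simp only [A]; fun_prop))
    (UnitAddCircle.integrable_prod_of_continuous (by simp only [G]; fun_prop)) key
  rw [hGi, integral_const_mul, integral_sub
    (UnitAddCircle.integrable_prod_of_continuous (by simp only [A]; fun_prop))
    (integrable_const _), hAi] at hint
  have hT0 : 0 ≤ progressionForm f fun _ => (1 : ℝ) := integral_nonneg fun p =>
    mul_nonneg (mul_nonneg (mul_nonneg (hf0 _) (hf0 _)) (hf0 _)) zero_le_one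
  rw [div_le_iff₀ (by positivity)]
  have : κ * (m / 2) ≤ κ * ((∫ x, f x) - m / 2) := by gcongr; linarith
  simp at hint
  nlinarith

/-- The weight `1 - cos 2πr` on the common difference `r`, which vanishes only at `r = 0`. -/
noncomputable def stepWeight (r : UnitAddCircle) : ℝ := 1 - (fourier 1 r).re

lemma continuous_stepWeight : Continuous stepWeight := by
  unfold stepWeight; fun_prop

lemma stepWeight_nonneg (r : UnitAddCircle) : 0 ≤ stepWeight r := by
  have := (Complex.re_le_norm (fourier 1 r)).trans_eq (norm_fourier_apply 1 r)
  unfold stepWeight; linarith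

lemma stepWeight_pos {r : UnitAddCircle} (hr : r ≠ 0) : 0 < stepWeight r := by
  refine (stepWeight_nonneg r).lt_of_ne' fun h => hr ?_
  have h1 : (fourier 1 r).re = 1 := by unfold stepWeight at h; linarith
  have h2 : fourier 1 r = 1 := by
    have h3 := norm_fourier_apply 1 r
    have h4 := Complex.sq_norm (fourier 1 r)
    rw [h3, Complex.normSq_apply, h1] at h4
    apply Complex.ext
    · simpa using h1
    · rw [Complex.one_im]; nlinarith
  rw [fourier_one] at h2
  apply AddCircle.injective_toCircle one_ne_zero
  rw [AddCircle.toCircle_zero]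
  exact Circle.ext (by simpa using h2)

lemma stepWeight_zero : stepWeight 0 = 0 := by simp [stepWeight]

/-- The bound of `exists_pos_le_progressionForm_one` persists with the weight `stepWeight`, because
differences `r` with `stepWeight r < η` have small measure and contribute at most `M ^ 3` each. -/
lemma exists_pos_le_progressionForm_stepWeight {M m : ℝ} (hM : 0 < M) (hm : 0 < m) :
    ∃ c : ℝ, 0 < c ∧ ∀ f : UnitAddCircle → ℝ, Continuous f → (∀ x, 0 ≤ f x) → (∀ x, f x ≤ M) →
      m ≤ ∫ x, f x → c ≤ progressionForm f stepWeight := by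
  obtain ⟨c, hc, hcf⟩ := exists_pos_le_progressionForm_one hM hm
  -- A continuous majorant of `1 - stepWeight / η`, supported where `stepWeight ≤ η`.
  let g : ℝ → UnitAddCircle → ℝ := fun η r => max (1 - stepWeight r / η) 0
  have hgc : ∀ η, Continuous (g η) := fun η => by
    have := continuous_stepWeight
    simp only [g]; fun_prop
  have hlim : Tendsto (fun η => ∫ r, g η r) (𝓝[>] 0) (𝓝 (∫ r : UnitAddCircle, (0 : ℝ))) := by
    refine tendsto_integral_filter_of_dominated_convergence (fun _ => 1)
      (.of_forall fun η => (hgc η).aestronglyMeasurable) ?_ (integrable_const _) ?_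
    · filter_upwards [self_mem_nhdsWithin] with η hη
      refine .of_forall fun r => ?_
      rw [Real.norm_of_nonneg (le_max_right _ _)]
      exact max_le (by linarith [div_nonneg (stepWeight_nonneg r) (le_of_lt hη)]) zero_le_one
    · have h0 : ∀ᵐ r : UnitAddCircle, r ≠ 0 := by
        have : volume ({0} : Set UnitAddCircle) = 0 := by
          rw [← Metric.closedBall_zero, AddCircle.volume_closedBall]; simp
        simpa [ae_iff] using this
      filter_upwards [h0] with r hr
      refine tendsto_const_nhds.congr' ?_
      filter_upwards [Ioo_mem_nhdsGT (stepWeight_pos hr)] with η hη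
      refine (max_eq_right ?_).symm
      have : 1 ≤ stepWeight r / η := by rw [le_div_iff₀ hη.1]; linarith [hη.2]
      linarith
  rw [integral_zero] at hlim
  obtain ⟨η, hη1, hη0⟩ := ((hlim.eventually (gt_mem_nhds (show 0 < c / (2 * M ^ 3) by positivity))).and
    self_mem_nhdsWithin).exists
  have hη0 : 0 < η := hη0
  refine ⟨η * (c / 2), by positivity, fun f hf hf0 hfM hfm => ?_⟩
  have hw := continuous_stepWeight
  have key : ∀ p : UnitAddCircle × UnitAddCircle,
      η * (f p.1 * f (p.1 + p.2) * f (p.1 + p.2 + p.2) * 1 - M ^ 3 * g η p.2)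
        ≤ f p.1 * f (p.1 + p.2) * f (p.1 + p.2 + p.2) * stepWeight p.2 := by
    intro p
    set F := f p.1 * f (p.1 + p.2) * f (p.1 + p.2 + p.2)
    have hF0 : 0 ≤ F := mul_nonneg (mul_nonneg (hf0 _) (hf0 _)) (hf0 _)
    have hFM : F ≤ M ^ 3 := by
      calc F ≤ M * M * M := by
            refine mul_le_mul (mul_le_mul ?_ ?_ ?_ ?_) ?_ ?_ ?_ <;>
              first | exact hfM _ | exact hf0 _ | positivity
        _ = _ := by ring
    have hg0 : 0 ≤ g η p.2 := le_max_right _ _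
    have hg1 : 1 - stepWeight p.2 / η ≤ g η p.2 := le_max_left _ _
    have hg2 : η - stepWeight p.2 ≤ η * g η p.2 := by
      have := mul_le_mul_of_nonneg_left hg1 hη0.le
      rwa [mul_sub, mul_one, mul_div_cancel₀ _ hη0.ne'] at this
    have h1 : F * (η * g η p.2) ≤ M ^ 3 * (η * g η p.2) := by gcongr
    have h2 := mul_le_mul_of_nonneg_left hg2 hF0
    linarith
  have hgi : ∫ p : UnitAddCircle × UnitAddCircle, g η p.2 = ∫ r, g η r := by
    rw [Measure.volume_eq_prod, integral_prod _
      (UnitAddCircle.integrable_prod_of_continuous (by fun_prop))]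
    simp
  have hint := integral_mono (μ := (volume : Measure (UnitAddCircle × UnitAddCircle)))
    (UnitAddCircle.integrable_prod_of_continuous (by fun_prop))
    (UnitAddCircle.integrable_prod_of_continuous (by fun_prop)) key
  rw [integral_const_mul, integral_sub
    (UnitAddCircle.integrable_prod_of_continuous (by fun_prop))
    (UnitAddCircle.integrable_prod_of_continuous (by fun_prop)), integral_const_mul, hgi] at hint
  change η * (progressionForm f (fun _ => 1) - _) ≤ progressionForm f stepWeight at hint
  refine le_trans ?_ hint
  have := hcf f hf hf0 hfM hfm
  rw [lt_div_iff₀ (by positivity)] at hη1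
  gcongr
  linarith

/-! ### Smoothing a measure by a tent -/

/-- The convolution of `ν` with the tent of width `h`, normalized to have integral one. -/
noncomputable def tentSmoothing (ν : Measure UnitAddCircle) (h : ℝ) (x : UnitAddCircle) : ℝ :=
  (h ^ 2)⁻¹ * ∫ y, tent h (x - y) ∂ν

/-- The Fourier coefficient `∫ e(-ky) dν(y)` of a measure on the circle. -/
noncomputable def circleFourierCoeff (ν : Measure UnitAddCircle) (k : ℤ) : ℂ :=
  ∫ y, fourier (-k) y ∂ν

section TentSmoothing

variable {ν : Measure UnitAddCircle} {h : ℝ}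

lemma tentSmoothing_nonneg (ν : Measure UnitAddCircle) (h : ℝ) (x : UnitAddCircle) :
    0 ≤ tentSmoothing ν h x :=
  mul_nonneg (by positivity) (integral_nonneg fun _ => tent_nonneg _ _)

lemma continuous_tentSmoothing [IsFiniteMeasure ν] (hh : 0 ≤ h) :
    Continuous (tentSmoothing ν h) := by
  have hc := continuous_tent h
  refine continuous_const.mul (continuous_of_dominated (bound := fun _ => h)
    (fun x => (by fun_prop : Continuous fun y => tent h (x - y)).aestronglyMeasurable)
    (fun x => .of_forall fun y => ?_) (integrable_const _)
    (.of_forall fun y => by fun_prop))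
  rw [Real.norm_of_nonneg (tent_nonneg _ _)]
  exact tent_le hh _

lemma tentSmoothing_le [IsFiniteMeasure ν] (hh : 0 < h) (x : UnitAddCircle) :
    tentSmoothing ν h x ≤ h⁻¹ * ν.real (Metric.closedBall x h) := by
  have hc := continuous_tent h
  have h1 : ∀ y, tent h (x - y) ≤ (Metric.closedBall x h).indicator (fun _ => h) y := by
    intro y
    by_cases hy : y ∈ Metric.closedBall x h
    · rw [Set.indicator_of_mem hy]; exact tent_le hh.le _
    · rw [Set.indicator_of_notMem hy, tent_eq_zero]
      rw [Metric.mem_closedBall, dist_comm, dist_eq_norm] at hy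
      linarith
  have h2 : ∫ y, tent h (x - y) ∂ν ≤ ν.real (Metric.closedBall x h) * h := by
    refine (integral_mono ?_ ?_ h1).trans_eq ?_
    · exact (by fun_prop : Continuous fun y => tent h (x - y)).integrable_of_hasCompactSupport
        (HasCompactSupport.of_compactSpace _)
    · exact (integrable_const _).indicator Metric.isClosed_closedBall.measurableSet
    · rw [integral_indicator_const _ Metric.isClosed_closedBall.measurableSet, smul_eq_mul]
  calc _ ≤ (h ^ 2)⁻¹ * (ν.real (Metric.closedBall x h) * h) := by
        unfold tentSmoothing; gcongr
    _ = _ := by field_simp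

lemma exists_near_of_tentSmoothing_ne_zero {F : Set UnitAddCircle} (hF : ν Fᶜ = 0)
    {x : UnitAddCircle} (hx : tentSmoothing ν h x ≠ 0) : ∃ y ∈ F, dist x y < h := by
  by_contra! H
  refine hx ?_
  unfold tentSmoothing
  rw [integral_eq_zero_of_ae, mul_zero]
  have : ∀ᵐ y ∂ν, y ∈ F := mem_ae_iff.2 hF
  filter_upwards [this] with y hy
  exact tent_eq_zero (by simpa [dist_eq_norm] using H y hy)

/-- The `k`-th Fourier coefficient of the tent of width `h` normalized to have integral one: the
factor by which `tentSmoothing` damps the frequency `k`. -/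
noncomputable def tentMultiplier (h : ℝ) (k : ℤ) : ℝ := tentCoeff h k / h ^ 2

lemma tentMultiplier_nonneg (h : ℝ) (k : ℤ) : 0 ≤ tentMultiplier h k :=
  div_nonneg (tentCoeff_nonneg h k) (sq_nonneg h)

lemma tentMultiplier_le_one (h : ℝ) (k : ℤ) : tentMultiplier h k ≤ 1 :=
  div_le_one_of_le₀ (tentCoeff_le h k) (sq_nonneg h)

/-- The Fourier coefficients of `tentSmoothing ν h`. -/
noncomputable def smoothedCoeff (ν : Measure UnitAddCircle) (h : ℝ) (k : ℤ) : ℂ :=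
  (tentMultiplier h k : ℂ) * circleFourierCoeff ν k

lemma norm_circleFourierCoeff_le [IsFiniteMeasure ν] (k : ℤ) :
    ‖circleFourierCoeff ν k‖ ≤ ν.real Set.univ := by
  refine (norm_integral_le_integral_norm _).trans_eq ?_
  simp [norm_fourier_apply, -fourier_apply]

lemma summable_tentCoeff (h : ℝ) : Summable (tentCoeff h) := by
  have h1 : Summable fun n : ℤ => 1 / (n : ℝ) ^ 2 + if n = 0 then h ^ 2 else 0 :=
    (Real.summable_one_div_int_pow.2 one_lt_two).add (hasSum_ite_eq 0 (h ^ 2)).summable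
  refine h1.of_nonneg_of_le (tentCoeff_nonneg h) fun n => ?_
  by_cases hn : n = 0
  · simp [hn, tentCoeff]
  · simpa [hn] using tentCoeff_le_one_div h hn

lemma summable_smoothedCoeff [IsFiniteMeasure ν] : Summable fun k => ‖smoothedCoeff ν h k‖ := by
  refine (((summable_tentCoeff h).div_const (h ^ 2)).mul_right (ν.real Set.univ)).of_nonneg_of_le
    (fun k => norm_nonneg _) fun k => ?_
  rw [smoothedCoeff, norm_mul, Complex.norm_real, Real.norm_of_nonneg (tentMultiplier_nonneg h k)]
  refine mul_le_mul_of_nonneg_left ?_ (tentMultiplier_nonneg h k)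
  exact norm_circleFourierCoeff_le k

lemma hasSum_tentSmoothing [IsFiniteMeasure ν] (h0 : 0 < h) (h1 : h ≤ 1 / 2) (x : UnitAddCircle) :
    HasSum (fun k => smoothedCoeff ν h k * fourier k x) (tentSmoothing ν h x : ℂ) := by
  have H := hasSum_integral_of_summable_integral_norm (μ := ν)
    (F := fun (k : ℤ) (y : UnitAddCircle) => (tentCoeff h k : ℂ) * fourier k (x - y))
    (fun k => (by fun_prop : Continuous fun y : UnitAddCircle =>
      (tentCoeff h k : ℂ) * fourier k (x - y)).integrable_of_hasCompactSupport
        (HasCompactSupport.of_compactSpace _))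
    (by
      simp only [norm_mul, norm_fourier_apply, Complex.norm_real, mul_one, integral_const,
        smul_eq_mul, Real.norm_of_nonneg (tentCoeff_nonneg h _)]
      exact (summable_tentCoeff h).mul_left _)
  simp_rw [(hasSum_tent h0 h1 _).tsum_eq, integral_complex_ofReal] at H
  have H2 := H.mul_left ((h ^ 2 : ℝ) : ℂ)⁻¹
  have e1 : (tentSmoothing ν h x : ℂ) = ((h ^ 2 : ℝ) : ℂ)⁻¹ * ((∫ y, tent h (x - y) ∂ν : ℝ) : ℂ) := by
    unfold tentSmoothing; push_cast; rfl
  rw [e1]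
  refine H2.congr_fun fun k => ?_
  have e2 : ∀ y : UnitAddCircle, fourier k (x - y) = fourier k x * fourier (-k) y := by
    intro y
    rw [sub_eq_add_neg, fourier_apply_add]
    simp [fourier_apply]
  simp_rw [e2, smoothedCoeff, tentMultiplier, circleFourierCoeff, integral_const_mul]
  push_cast
  ring

lemma integral_tentSmoothing [IsFiniteMeasure ν] (h0 : 0 < h) (h1 : h ≤ 1 / 2) :
    ∫ x, tentSmoothing ν h x = ν.real Set.univ := by
  have H := integral_mul_fourier_of_hasSum (summable_smoothedCoeff (ν := ν) (h := h))
    (hasSum_tentSmoothing h0 h1) 0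
  have h2 : smoothedCoeff ν h 0 = (ν.real Set.univ : ℂ) := by
    simp [smoothedCoeff, tentMultiplier, tentCoeff, circleFourierCoeff, h0.ne']
  simp only [fourier_zero, mul_one, neg_zero, h2, integral_complex_ofReal] at H
  exact_mod_cast H

end TentSmoothing

/-- If a closed set has no non-trivial progression, then progressions in a small neighbourhood of it
have a small common difference, by compactness. -/
lemma exists_stepWeight_lt_of_infDist_lt {F : Set UnitAddCircle} (hF : IsClosed F)
    (hF0 : F.Nonempty)
    (hAP : ∀ x r : UnitAddCircle, x ∈ F → x + r ∈ F → x + r + r ∈ F → r = 0) {η : ℝ}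
    (hη : 0 < η) :
    ∃ ρ : ℝ, 0 < ρ ∧ ∀ x r : UnitAddCircle, Metric.infDist x F < ρ → Metric.infDist (x + r) F < ρ →
      Metric.infDist (x + r + r) F < ρ → stepWeight r < η := by
  have hw := continuous_stepWeight
  let g : UnitAddCircle × UnitAddCircle → ℝ := fun p =>
    Metric.infDist p.1 F + Metric.infDist (p.1 + p.2) F + Metric.infDist (p.1 + p.2 + p.2) F
  have hg : Continuous g := by
    have := Metric.continuous_infDist_pt F
    simp only [g]; fun_prop
  let S : Set (UnitAddCircle × UnitAddCircle) := {p | η ≤ stepWeight p.2}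
  have hS : IsCompact S :=
    (isClosed_le continuous_const (hw.comp continuous_snd)).isCompact
  rcases S.eq_empty_or_nonempty with hS0 | hS0
  · refine ⟨1, one_pos, fun x r _ _ _ => not_le.1 fun h => ?_⟩
    exact (Set.eq_empty_iff_forall_notMem.1 hS0 (x, r)) h
  obtain ⟨p, hp, hmin⟩ := hS.exists_isMinOn hS0 hg.continuousOn
  have hpos : 0 < g p := by
    have i1 := Metric.infDist_nonneg (x := p.1) (s := F)
    have i2 := Metric.infDist_nonneg (x := p.1 + p.2) (s := F)
    have i3 := Metric.infDist_nonneg (x := p.1 + p.2 + p.2) (s := F)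
    refine (by positivity : 0 ≤ g p).lt_of_ne' fun h0 => ?_
    simp only [g] at h0
    have := hAP p.1 p.2 ((hF.mem_iff_infDist_zero hF0).2 (by linarith))
      ((hF.mem_iff_infDist_zero hF0).2 (by linarith))
      ((hF.mem_iff_infDist_zero hF0).2 (by linarith))
    have hp' : η ≤ stepWeight p.2 := hp
    rw [this, stepWeight_zero] at hp'
    linarith
  refine ⟨g p / 3, by positivity, fun x r a b c => not_le.1 fun h => ?_⟩
  have : g p ≤ g (x, r) := hmin (show (x, r) ∈ S from h)
  simp only [g] at this a b c
  linarith

lemma summable_one_add_abs_int_rpow {b : ℝ} (hb : 1 < b) :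
    Summable fun n : ℤ => (1 + |(n : ℝ)|) ^ (-b) := by
  have h1 : Summable fun n : ℤ => |(n : ℝ)| ^ (-b) + if n = 0 then (1 : ℝ) else 0 :=
    (Real.summable_abs_int_rpow hb).add (hasSum_ite_eq 0 (1 : ℝ)).summable
  refine h1.of_nonneg_of_le (fun n => by positivity) fun n => ?_
  by_cases hn : n = 0
  · simp [hn]; positivity
  · have : 0 < |(n : ℝ)| := by simpa using hn
    simp only [hn, if_false, add_zero]
    exact Real.rpow_le_rpow_of_nonpos this (by linarith) (by linarith)

/-! ### Stability of the progression form under change of scale -/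

section Stability

variable {ν : Measure UnitAddCircle} {β D γ : ℝ}

lemma rpow_neg_le_of_le_two_mul {s : ℝ} (hs0 : 0 ≤ s) (hs : s ≤ 1) {a b : ℝ} (ha : 0 < a)
    (hab : a ≤ 2 * b) : b ^ (-s) ≤ 2 * a ^ (-s) := by
  calc b ^ (-s) ≤ (a / 2) ^ (-s) :=
        Real.rpow_le_rpow_of_nonpos (by positivity) (by linarith) (by linarith)
    _ = 2 ^ s * a ^ (-s) := by
        rw [Real.div_rpow ha.le (by norm_num), Real.rpow_neg (by norm_num : (0 : ℝ) ≤ 2)]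
        field_simp
    _ ≤ 2 ^ (1 : ℝ) * a ^ (-s) := by
        gcongr
        norm_num
    _ = _ := by rw [Real.rpow_one]

lemma one_sub_tentMultiplier_le {h : ℝ} (h0 : 0 < h) (hγ : 0 < γ) (hγ1 : γ ≤ 1) {c k : ℤ}
    (hk : |(k : ℝ)| ≤ 2 * (1 + |(c : ℝ)|)) :
    1 - tentMultiplier h k ≤ (4 * Real.pi) ^ γ * (1 + |(c : ℝ)|) ^ γ * h ^ γ := by
  have h1 := sq_sub_tentCoeff_le h0 k hγ hγ1
  have hp := Real.pi_pos
  calc 1 - tentMultiplier h k = (h ^ 2 - tentCoeff h k) / h ^ 2 := by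
        unfold tentMultiplier; field_simp
    _ ≤ (2 * Real.pi * |(k : ℝ)| * h) ^ γ := by
        rw [div_le_iff₀ (by positivity)]; linarith
    _ ≤ (4 * Real.pi * (1 + |(c : ℝ)|) * h) ^ γ := by
        apply Real.rpow_le_rpow (by positivity) _ hγ.le
        have := mul_le_mul_of_nonneg_left hk (by positivity : 0 ≤ 2 * Real.pi * h)
        linarith
    _ = _ := by
        rw [Real.mul_rpow (by positivity) h0.le, Real.mul_rpow (by positivity) (by positivity)]

lemma abs_mul_mul_sub_one_le {x y z δ : ℝ} (hx : 0 ≤ x) (hx1 : x ≤ 1) (hy : 0 ≤ y) (hy1 : y ≤ 1)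
    (hz : 0 ≤ z) (hz1 : z ≤ 1) (h1 : 1 - x ≤ δ) (h2 : 1 - y ≤ δ) (h3 : 1 - z ≤ δ) :
    |x * y * z - 1| ≤ 3 * δ := by
  have hxy : x * y ≤ 1 := mul_le_one₀ hx1 hy hy1
  have hxy0 : 0 ≤ x * y := by positivity
  have hxyz : x * y * z ≤ 1 := mul_le_one₀ hxy hz hz1
  rw [abs_sub_comm, abs_of_nonneg (by linarith)]
  nlinarith [mul_nonneg hx (sub_nonneg.2 hy1), mul_nonneg hxy0 (sub_nonneg.2 hz1)]

/-- For `|m| ≤ 1`, the three frequencies `c`, `c + m`, `-(2c + m)` of the expanded progression form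
have comparable size. -/
lemma abs_frequency_bounds {m : ℤ} (hm : |m| ≤ 1) (c : ℤ) :
    (1 + |(c : ℝ)| ≤ 2 * (1 + |((c + m : ℤ) : ℝ)|)) ∧
    (1 + |(c : ℝ)| ≤ 2 * (1 + |((-(2 * c + m) : ℤ) : ℝ)|)) ∧
    |(c : ℝ)| ≤ 2 * (1 + |(c : ℝ)|) ∧ |((c + m : ℤ) : ℝ)| ≤ 2 * (1 + |(c : ℝ)|) ∧
    |((-(2 * c + m) : ℤ) : ℝ)| ≤ 2 * (1 + |(c : ℝ)|) := by
  norm_cast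
  refine ⟨?_, ?_, ?_, ?_, ?_⟩ <;> grind

/-- The exponent `γ` is chosen so that `3β/2 = 1 + 2γ`: one `γ` of the decay is kept for summability,
the other is spent on the comparison of two scales. -/
lemma norm_triple_coeff_le (hβ : 2 / 3 < β) (hβ' : β ≤ 1) (hγ : γ = (3 * β / 2 - 1) / 2)
    (hD : ∀ k, ‖circleFourierCoeff ν k‖ ≤ D * (1 + |(k : ℝ)|) ^ (-(β / 2)))
    {m : ℤ} (hm : |m| ≤ 1) (c : ℤ) :
    ‖circleFourierCoeff ν c * circleFourierCoeff ν (c + m) * circleFourierCoeff ν (-(2 * c + m))‖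
      ≤ 4 * D ^ 3 * (1 + |(c : ℝ)|) ^ (-(1 + 2 * γ)) := by
  obtain ⟨i1, i2, -⟩ := abs_frequency_bounds hm c
  have hD0 : 0 ≤ D := by
    have := (norm_nonneg _).trans (hD 0)
    simpa using this
  set b := (1 + |(c : ℝ)|) ^ (-(β / 2)) with hb
  have hb0 : 0 ≤ b := by positivity
  have j1 := (hD (c + m)).trans (mul_le_mul_of_nonneg_left
    (rpow_neg_le_of_le_two_mul (by linarith) (by linarith) (by positivity) i1) hD0)
  have j2 := (hD (-(2 * c + m))).trans (mul_le_mul_of_nonneg_left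
    (rpow_neg_le_of_le_two_mul (by linarith) (by linarith) (by positivity) i2) hD0)
  rw [norm_mul, norm_mul]
  calc _ ≤ (D * b) * (D * (2 * b)) * (D * (2 * b)) := by
        gcongr
        exact hD c
    _ = 4 * D ^ 3 * (b * b * b) := by ring
    _ = _ := by
        rw [hb, ← Real.rpow_add (by positivity), ← Real.rpow_add (by positivity), hγ]
        congr 2
        ring

lemma norm_triple_smoothedCoeff_le (hβ : 2 / 3 < β) (hβ' : β ≤ 1)
    (hγ : γ = (3 * β / 2 - 1) / 2)
    (hD : ∀ k, ‖circleFourierCoeff ν k‖ ≤ D * (1 + |(k : ℝ)|) ^ (-(β / 2)))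
    (h : ℝ) (c : ℤ) :
    ‖smoothedCoeff ν h c * smoothedCoeff ν h (c + 0) * smoothedCoeff ν h (-(2 * c + 0))‖
      ≤ 4 * D ^ 3 * (1 + |(c : ℝ)|) ^ (-(1 + γ)) := by
  have hD0 : 0 ≤ D := by
    have := (norm_nonneg _).trans (hD 0)
    simpa using this
  have h1 : ∀ k, ‖smoothedCoeff ν h k‖ ≤ ‖circleFourierCoeff ν k‖ := fun k => by
    have := mul_le_mul_of_nonneg_right (tentMultiplier_le_one h k)
      (norm_nonneg (circleFourierCoeff ν k))
    rw [smoothedCoeff, norm_mul, Complex.norm_real,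
      Real.norm_of_nonneg (tentMultiplier_nonneg h k)]
    simpa using this
  have h2 := norm_triple_coeff_le hβ hβ' hγ hD (m := 0) (by simp) c
  rw [norm_mul, norm_mul] at h2 ⊢
  calc _ ≤ _ := by gcongr <;> exact h1 _
    _ ≤ _ := h2
    _ ≤ _ := by
      gcongr 4 * D ^ 3 * ?_
      exact Real.rpow_le_rpow_of_exponent_le (by linarith [abs_nonneg (c : ℝ)]) (by linarith)

lemma norm_triple_smoothedCoeff_sub_le (hβ : 2 / 3 < β) (hβ' : β ≤ 1)
    (hγ : γ = (3 * β / 2 - 1) / 2)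
    (hD : ∀ k, ‖circleFourierCoeff ν k‖ ≤ D * (1 + |(k : ℝ)|) ^ (-(β / 2)))
    {m : ℤ} (hm : |m| ≤ 1) {h h' : ℝ} (h0 : 0 < h) (h0' : 0 < h') (c : ℤ) :
    ‖smoothedCoeff ν h c * smoothedCoeff ν h (c + m) * smoothedCoeff ν h (-(2 * c + m))
      - smoothedCoeff ν h' c * smoothedCoeff ν h' (c + m) * smoothedCoeff ν h' (-(2 * c + m))‖
      ≤ 12 * (4 * Real.pi) ^ γ * D ^ 3 * (h ^ γ + h' ^ γ) * (1 + |(c : ℝ)|) ^ (-(1 + γ)) := by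
  have hD0 : 0 ≤ D := by
    have := (norm_nonneg _).trans (hD 0)
    simpa using this
  have hγ0 : 0 < γ := by linarith
  have hγ1 : γ ≤ 1 := by linarith
  obtain ⟨-, -, i1, i2, i3⟩ := abs_frequency_bounds hm c
  let κ : ℝ → ℝ := fun h =>
    tentMultiplier h c * tentMultiplier h (c + m) * tentMultiplier h (-(2 * c + m))
  have hκ : ∀ h : ℝ, 0 < h → |κ h - 1| ≤ 3 * ((4 * Real.pi) ^ γ * (1 + |(c : ℝ)|) ^ γ * h ^ γ) :=
    fun h h0 => abs_mul_mul_sub_one_le (tentMultiplier_nonneg _ _) (tentMultiplier_le_one _ _)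
      (tentMultiplier_nonneg _ _) (tentMultiplier_le_one _ _) (tentMultiplier_nonneg _ _)
      (tentMultiplier_le_one _ _) (one_sub_tentMultiplier_le h0 hγ0 hγ1 i1)
      (one_sub_tentMultiplier_le h0 hγ0 hγ1 i2) (one_sub_tentMultiplier_le h0 hγ0 hγ1 i3)
  have h1 : smoothedCoeff ν h c * smoothedCoeff ν h (c + m) * smoothedCoeff ν h (-(2 * c + m))
      - smoothedCoeff ν h' c * smoothedCoeff ν h' (c + m) * smoothedCoeff ν h' (-(2 * c + m))
      = ((κ h - κ h' : ℝ) : ℂ) * (circleFourierCoeff ν c * circleFourierCoeff ν (c + m)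
        * circleFourierCoeff ν (-(2 * c + m))) := by
    simp only [κ, smoothedCoeff]
    push_cast
    ring
  have h2 : |κ h - κ h'| ≤ 3 * (4 * Real.pi) ^ γ * (1 + |(c : ℝ)|) ^ γ * (h ^ γ + h' ^ γ) := by
    have := abs_sub_le (κ h) 1 (κ h')
    rw [abs_sub_comm 1] at this
    linarith [hκ h h0, hκ h' h0']
  rw [h1, norm_mul, Complex.norm_real, Real.norm_eq_abs]
  calc _ ≤ (3 * (4 * Real.pi) ^ γ * (1 + |(c : ℝ)|) ^ γ * (h ^ γ + h' ^ γ)) *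
        (4 * D ^ 3 * (1 + |(c : ℝ)|) ^ (-(1 + 2 * γ))) := by
        gcongr
        exact norm_triple_coeff_le hβ hβ' hγ hD hm c
    _ = 12 * (4 * Real.pi) ^ γ * D ^ 3 * (h ^ γ + h' ^ γ) *
        ((1 + |(c : ℝ)|) ^ γ * (1 + |(c : ℝ)|) ^ (-(1 + 2 * γ))) := by ring
    _ = _ := by
        rw [← Real.rpow_add (by positivity)]
        congr 2
        ring

/-- The sum `∑ (1 + |c|) ^ (-(1 + γ))` over `c ∈ ℤ`, finite for `γ > 0`. -/
noncomputable def decaySum (γ : ℝ) : ℝ := ∑' c : ℤ, (1 + |(c : ℝ)|) ^ (-(1 + γ))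

lemma decaySum_nonneg (γ : ℝ) : 0 ≤ decaySum γ := tsum_nonneg fun _ => by positivity

lemma ofReal_progressionForm (f g : UnitAddCircle → ℝ) :
    ((progressionForm f g : ℝ) : ℂ) =
      progressionForm (fun x => (f x : ℂ)) (fun r => (g r : ℂ)) := by
  unfold progressionForm
  rw [← integral_complex_ofReal]
  push_cast
  rfl

lemma ofReal_stepWeight (r : UnitAddCircle) :
    (stepWeight r : ℂ) = fourier 0 r - fourier 1 r / 2 - fourier (-1) r / 2 := by
  have := Complex.re_eq_add_conj (fourier 1 r)
  rw [← fourier_neg] at this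
  unfold stepWeight
  push_cast
  rw [this, fourier_zero]
  ring

lemma progressionForm_stepWeight_eq {f : UnitAddCircle → ℝ} (hf : Continuous f) :
    ((progressionForm f stepWeight : ℝ) : ℂ) =
      progressionForm (fun x => (f x : ℂ)) (fourier 0)
      - progressionForm (fun x => (f x : ℂ)) (fourier 1) / 2
      - progressionForm (fun x => (f x : ℂ)) (fourier (-1)) / 2 := by
  rw [ofReal_progressionForm]
  unfold progressionForm
  rw [← integral_div, ← integral_div, ← integral_sub, ← integral_sub]
  · congr 1 with p
    simp only [ofReal_stepWeight]
    ring
  all_goals exact UnitAddCircle.integrable_prod_of_continuous (by fun_prop)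

lemma progressionForm_one_le [IsFiniteMeasure ν] (hβ : 2 / 3 < β) (hβ' : β ≤ 1)
    (hγ : γ = (3 * β / 2 - 1) / 2)
    (hD : ∀ k, ‖circleFourierCoeff ν k‖ ≤ D * (1 + |(k : ℝ)|) ^ (-(β / 2)))
    {h : ℝ} (h0 : 0 < h) (h1 : h ≤ 1 / 2) :
    progressionForm (tentSmoothing ν h) (fun _ => 1) ≤ 4 * D ^ 3 * decaySum γ := by
  have hc := continuous_tentSmoothing (ν := ν) h0.le
  have H := hasSum_progressionForm_fourier (by fun_prop) (summable_smoothedCoeff (ν := ν) (h := h))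
    (hasSum_tentSmoothing h0 h1) 0
  have hs := (summable_one_add_abs_int_rpow (b := 1 + γ) (by linarith)).mul_left (4 * D ^ 3)
  have h2 := tsum_of_norm_bounded hs.hasSum (norm_triple_smoothedCoeff_le hβ hβ' hγ hD h)
  rw [H.tsum_eq, tsum_mul_left] at h2
  have h3 : ((progressionForm (tentSmoothing ν h) (fun _ => 1) : ℝ) : ℂ) =
      progressionForm (fun x => (tentSmoothing ν h x : ℂ)) (fourier 0) := by
    rw [ofReal_progressionForm]
    congr 1 with r
    simp
  rw [← h3, Complex.norm_real] at h2
  exact (le_abs_self _).trans h2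

lemma norm_progressionForm_fourier_sub_le [IsFiniteMeasure ν] (hβ : 2 / 3 < β) (hβ' : β ≤ 1)
    (hγ : γ = (3 * β / 2 - 1) / 2)
    (hD : ∀ k, ‖circleFourierCoeff ν k‖ ≤ D * (1 + |(k : ℝ)|) ^ (-(β / 2)))
    {h h' : ℝ} (h0 : 0 < h) (h1 : h ≤ 1 / 2) (h0' : 0 < h') (h1' : h' ≤ 1 / 2)
    {m : ℤ} (hm : |m| ≤ 1) :
    ‖progressionForm (fun x => (tentSmoothing ν h x : ℂ)) (fourier m) -
      progressionForm (fun x => (tentSmoothing ν h' x : ℂ)) (fourier m)‖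
      ≤ 12 * (4 * Real.pi) ^ γ * D ^ 3 * (h ^ γ + h' ^ γ) * decaySum γ := by
  have hc := continuous_tentSmoothing (ν := ν) h0.le
  have hc' := continuous_tentSmoothing (ν := ν) h0'.le
  have H := hasSum_progressionForm_fourier (by fun_prop) (summable_smoothedCoeff (ν := ν) (h := h))
    (hasSum_tentSmoothing h0 h1) m
  have H' := hasSum_progressionForm_fourier (by fun_prop)
    (summable_smoothedCoeff (ν := ν) (h := h')) (hasSum_tentSmoothing h0' h1') m
  have hs := (summable_one_add_abs_int_rpow (b := 1 + γ) (by linarith)).mul_left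
    (12 * (4 * Real.pi) ^ γ * D ^ 3 * (h ^ γ + h' ^ γ))
  have h2 := tsum_of_norm_bounded hs.hasSum
    (norm_triple_smoothedCoeff_sub_le hβ hβ' hγ hD hm h0 h0')
  rwa [(H.sub H').tsum_eq, tsum_mul_left] at h2

/-- The weighted count of progressions hardly depends on the scale of the smoothing. -/
lemma progressionForm_stepWeight_sub_le [IsFiniteMeasure ν] (hβ : 2 / 3 < β) (hβ' : β ≤ 1)
    (hγ : γ = (3 * β / 2 - 1) / 2)
    (hD : ∀ k, ‖circleFourierCoeff ν k‖ ≤ D * (1 + |(k : ℝ)|) ^ (-(β / 2)))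
    {h h' : ℝ} (h0 : 0 < h) (h1 : h ≤ 1 / 2) (h0' : 0 < h') (h1' : h' ≤ 1 / 2) :
    progressionForm (tentSmoothing ν h) stepWeight - progressionForm (tentSmoothing ν h') stepWeight
      ≤ 24 * (4 * Real.pi) ^ γ * decaySum γ * D ^ 3 * (h ^ γ + h' ^ γ) := by
  have H := fun m (hm : |m| ≤ 1) => norm_progressionForm_fourier_sub_le hβ hβ' hγ hD h0 h1 h0' h1'
    (m := m) hm
  refine (le_abs_self _).trans ?_
  rw [← Real.norm_eq_abs, ← Complex.norm_real]
  push_cast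
  rw [progressionForm_stepWeight_eq (continuous_tentSmoothing h0.le),
    progressionForm_stepWeight_eq (continuous_tentSmoothing h0'.le)]
  generalize hA : (fun x => (tentSmoothing ν h x : ℂ)) = f at H ⊢
  generalize hA' : (fun x => (tentSmoothing ν h' x : ℂ)) = f' at H ⊢
  have e : progressionForm f (fourier 0) - progressionForm f (fourier 1) / 2
      - progressionForm f (fourier (-1)) / 2 - (progressionForm f' (fourier 0)
      - progressionForm f' (fourier 1) / 2 - progressionForm f' (fourier (-1)) / 2)
      = (progressionForm f (fourier 0) - progressionForm f' (fourier 0))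
      - (progressionForm f (fourier 1) - progressionForm f' (fourier 1)) / 2
      - (progressionForm f (fourier (-1)) - progressionForm f' (fourier (-1))) / 2 := by ring
  rw [e]
  refine (norm_sub_le _ _).trans ((add_le_add_left (norm_sub_le _ _) _).trans ?_)
  rw [norm_div, norm_div, Complex.norm_two]
  linarith [H 0 (by simp), H 1 (by simp), H (-1) (by simp)]

end Stability

/-- A closed set in the circle carrying a measure with Fourier decay contains a non-trivial
progression, if at one scale `h` the weighted count of progressions exceeds the error of passing
from `h` to finer scales. -/
theorem exists_progression_of_fourier_decay {β γ D c h : ℝ} (hβ : 2 / 3 < β) (hβ' : β ≤ 1)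
    (hγ : γ = (3 * β / 2 - 1) / 2) {ν : Measure UnitAddCircle} [IsFiniteMeasure ν]
    (hD : ∀ k, ‖circleFourierCoeff ν k‖ ≤ D * (1 + |(k : ℝ)|) ^ (-(β / 2)))
    {F : Set UnitAddCircle} (hF : IsClosed F) (hνF : ν Fᶜ = 0) (h0 : 0 < h) (h1 : h ≤ 1 / 2)
    (hc : c ≤ progressionForm (tentSmoothing ν h) stepWeight)
    (hsmall : 24 * (4 * Real.pi) ^ γ * decaySum γ * D ^ 3 * h ^ γ < c) :
    ∃ x r : UnitAddCircle, r ≠ 0 ∧ x ∈ F ∧ x + r ∈ F ∧ x + r + r ∈ F := by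
  by_contra! hAP
  replace hAP : ∀ x r : UnitAddCircle, x ∈ F → x + r ∈ F → x + r + r ∈ F → r = 0 :=
    fun x r a b d => by_contra fun hr => hAP x r hr a b d
  have hγ0 : 0 < γ := by linarith
  have hD0 : 0 ≤ D := by
    have := (norm_nonneg _).trans (hD 0)
    simpa using this
  set K := 24 * (4 * Real.pi) ^ γ * decaySum γ * D ^ 3 with hK
  have hZ := decaySum_nonneg γ
  set δ := c - K * h ^ γ with hδ
  have hδ0 : 0 < δ := by linarith
  rcases F.eq_empty_or_nonempty with hF0 | hF0
  · have hν : ν = 0 := by simpa [hF0] using hνF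
    have : progressionForm (tentSmoothing ν h) stepWeight = 0 := by
      simp [progressionForm, tentSmoothing, hν]
    have : 0 ≤ K * h ^ γ := by positivity
    linarith
  set L := 4 * D ^ 3 * decaySum γ with hL
  have hL0 : 0 ≤ L := by positivity
  obtain ⟨ρ, hρ, hρF⟩ := exists_stepWeight_lt_of_infDist_lt hF hF0 hAP
    (show 0 < δ / (4 * (L + 1)) by positivity)
  have hlim : Tendsto (fun h' : ℝ => K * h' ^ γ) (𝓝[>] 0) (𝓝 0) := by
    have := ((Real.continuous_rpow_const hγ0.le).tendsto 0).const_mul K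
    rw [Real.zero_rpow hγ0.ne', mul_zero] at this
    exact this.mono_left nhdsWithin_le_nhds
  obtain ⟨h', hh1, hh2, hh3⟩ := ((hlim.eventually (gt_mem_nhds (show 0 < δ / 2 by positivity))).and
    (Ioo_mem_nhdsGT (show 0 < min ρ (1 / 2) by positivity))).exists
  have h0' : 0 < h' := hh2
  have hh4 : h' ≤ 1 / 2 := hh3.le.trans (min_le_right _ _)
  have hh5 : h' < ρ := hh3.trans_le (min_le_left _ _)
  have hfc := continuous_tentSmoothing (ν := ν) h0'.le
  have hw := continuous_stepWeight
  -- At the finer scale `h'` every progression seen by the smoothing lies within `ρ` of `F`.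
  have hnear : ∀ x, tentSmoothing ν h' x ≠ 0 → Metric.infDist x F < ρ := fun x hx => by
    obtain ⟨y, hy, hxy⟩ := exists_near_of_tentSmoothing_ne_zero hνF hx
    exact (Metric.infDist_le_dist_of_mem hy).trans_lt (hxy.trans hh5)
  have hpt : ∀ p : UnitAddCircle × UnitAddCircle,
      tentSmoothing ν h' p.1 * tentSmoothing ν h' (p.1 + p.2) *
        tentSmoothing ν h' (p.1 + p.2 + p.2) * stepWeight p.2 ≤
      δ / (4 * (L + 1)) * (tentSmoothing ν h' p.1 * tentSmoothing ν h' (p.1 + p.2) *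
        tentSmoothing ν h' (p.1 + p.2 + p.2) * 1) := by
    intro p
    by_cases hz : tentSmoothing ν h' p.1 * tentSmoothing ν h' (p.1 + p.2) *
        tentSmoothing ν h' (p.1 + p.2 + p.2) = 0
    · rw [hz]; simp
    · have hz' := hz
      rw [← ne_eq, mul_ne_zero_iff, mul_ne_zero_iff] at hz'
      have := hρF p.1 p.2 (hnear _ hz'.1.1) (hnear _ hz'.1.2) (hnear _ hz'.2)
      have hnn : 0 ≤ tentSmoothing ν h' p.1 * tentSmoothing ν h' (p.1 + p.2) *
          tentSmoothing ν h' (p.1 + p.2 + p.2) :=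
        mul_nonneg (mul_nonneg (tentSmoothing_nonneg _ _ _) (tentSmoothing_nonneg _ _ _))
          (tentSmoothing_nonneg _ _ _)
      nlinarith
  have hint := integral_mono (μ := (volume : Measure (UnitAddCircle × UnitAddCircle)))
    (UnitAddCircle.integrable_prod_of_continuous (by fun_prop))
    (UnitAddCircle.integrable_prod_of_continuous (by fun_prop)) hpt
  rw [integral_const_mul] at hint
  change progressionForm (tentSmoothing ν h') stepWeight ≤
    _ * progressionForm (tentSmoothing ν h') (fun _ => 1) at hint
  have hone := progressionForm_one_le hβ hβ' hγ hD h0' hh4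
  have hsub := progressionForm_stepWeight_sub_le hβ hβ' hγ hD h0 h1 h0' hh4
  have h6 : δ / (4 * (L + 1)) * progressionForm (tentSmoothing ν h') (fun _ => 1) ≤ δ / 4 := by
    calc _ ≤ δ / (4 * (L + 1)) * (L + 1) := by gcongr; linarith
      _ = _ := by field_simp
  rw [mul_add] at hsub
  linarith

/-! ### Localizing a measure to an arc -/

section Localization

/-- The product of `ν` with the tent of width `h` centred at `t`. -/
noncomputable def localize (ν : Measure UnitAddCircle) (h : ℝ) (t : UnitAddCircle) :
    Measure UnitAddCircle :=
  ν.withDensity fun y => ENNReal.ofReal (tent h (y - t))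

variable {ν : Measure UnitAddCircle} {h : ℝ} {t : UnitAddCircle}

lemma integrable_tent_sub [IsFiniteMeasure ν] : Integrable (fun y => tent h (y - t)) ν := by
  have := continuous_tent h
  exact (by fun_prop : Continuous fun y => tent h (y - t)).integrable_of_hasCompactSupport
    (HasCompactSupport.of_compactSpace _)

instance isFiniteMeasure_localize [IsFiniteMeasure ν] : IsFiniteMeasure (localize ν h t) :=
  isFiniteMeasure_withDensity_ofReal integrable_tent_sub.hasFiniteIntegral

lemma measurable_tent_sub : Measurable fun y => ENNReal.ofReal (tent h (y - t)) := by
  have := continuous_tent h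
  exact ENNReal.measurable_ofReal.comp (by fun_prop : Continuous fun y => tent h (y - t)).measurable

lemma integral_localize {E : Type*} [NormedAddCommGroup E] [NormedSpace ℝ E]
    (g : UnitAddCircle → E) : ∫ y, g y ∂(localize ν h t) = ∫ y, tent h (y - t) • g y ∂ν := by
  rw [localize, integral_withDensity_eq_integral_toReal_smul measurable_tent_sub
    (.of_forall fun _ => ENNReal.ofReal_lt_top)]
  simp_rw [ENNReal.toReal_ofReal (tent_nonneg _ _)]

lemma measureReal_univ_localize :
    (localize ν h t).real Set.univ = ∫ y, tent h (y - t) ∂ν := by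
  have := integral_localize (ν := ν) (h := h) (t := t) (fun _ => (1 : ℝ))
  simpa using this

lemma localize_le (hh0 : 0 ≤ h) (hh : h ≤ 1) : localize ν h t ≤ ν := by
  calc localize ν h t ≤ ν.withDensity 1 := by
        refine withDensity_mono (.of_forall fun y => ?_)
        simpa using (tent_le hh0 (y - t)).trans hh
    _ = ν := withDensity_one

lemma localize_compl_closedBall : localize ν h t (Metric.closedBall t h)ᶜ = 0 := by
  rw [localize, withDensity_apply _ Metric.isClosed_closedBall.measurableSet.compl]
  refine (setLIntegral_congr_fun Metric.isClosed_closedBall.measurableSet.compl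
    fun y hy => ?_).trans (lintegral_zero)
  rw [Set.mem_compl_iff, Metric.mem_closedBall, dist_eq_norm] at hy
  simp [tent_eq_zero (h := h) (x := y - t) (by linarith)]

lemma integral_tent (h0 : 0 < h) (h1 : h ≤ 1 / 2) : ∫ x, tent h x = h ^ 2 := by
  have hs : Summable fun k => ‖(tentCoeff h k : ℂ)‖ := by
    simp_rw [Complex.norm_real, Real.norm_of_nonneg (tentCoeff_nonneg h _)]
    exact summable_tentCoeff h
  have H := integral_mul_fourier_of_hasSum hs (hasSum_tent h0 h1) 0
  simp only [fourier_zero, mul_one, neg_zero, integral_complex_ofReal, tentCoeff, if_true] at H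
  exact_mod_cast H

/-- Some translate of the tent captures at least its average share of the mass. -/
lemma exists_le_integral_tent_sub (ν : Measure UnitAddCircle) [IsFiniteMeasure ν] (h0 : 0 < h)
    (h1 : h ≤ 1 / 2) : ∃ t, h ^ 2 * ν.real Set.univ ≤ ∫ y, tent h (y - t) ∂ν := by
  have hc := continuous_tent h
  have hcont : Continuous (Function.uncurry fun t y : UnitAddCircle => tent h (y - t)) := by
    unfold Function.uncurry; fun_prop
  have hsw := integral_integral_swap_of_hasCompactSupport hcont
    (HasCompactSupport.of_compactSpace _) (μ := volume) (ν := ν)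
  have h2 : ∀ y : UnitAddCircle, ∫ t, tent h (y - t) = h ^ 2 := fun y => by
    rw [integral_sub_left_eq_self (μ := (volume : Measure UnitAddCircle)) (tent h) y,
      integral_tent h0 h1]
  simp_rw [h2] at hsw
  have hi : Integrable (fun t : UnitAddCircle => ∫ y, tent h (y - t) ∂ν) := by
    have : Integrable (Function.uncurry fun t y : UnitAddCircle => tent h (y - t))
        ((volume : Measure UnitAddCircle).prod ν) :=
      hcont.integrable_of_hasCompactSupport (HasCompactSupport.of_compactSpace _)
    exact this.integral_prod_left
  obtain ⟨t, ht⟩ := exists_integral_le hi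
  refine ⟨t, ?_⟩
  rw [hsw] at ht
  simpa [mul_comm] using ht

/-- The factor by which a Fourier decay bound with exponent `-s` grows under `localize`; the sum
converges for `s < 1` as the tent coefficients are `O(l⁻²)`. -/
noncomputable def localizeConst (h s : ℝ) : ℝ := ∑' l : ℤ, tentCoeff h l * (1 + |(l : ℝ)|) ^ s

lemma summable_localizeConst {s : ℝ} (hs : s < 1) :
    Summable fun l : ℤ => tentCoeff h l * (1 + |(l : ℝ)|) ^ s := by
  have h1 : Summable fun n : ℤ => 4 * (1 + |(n : ℝ)|) ^ (-(2 - s)) + if n = 0 then h ^ 2 else 0 :=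
    ((summable_one_add_abs_int_rpow (by linarith)).mul_left 4).add (hasSum_ite_eq 0 (h ^ 2)).summable
  refine h1.of_nonneg_of_le (fun n => mul_nonneg (tentCoeff_nonneg h n) (by positivity)) fun n => ?_
  by_cases hn : n = 0
  · simp [hn, tentCoeff]
  · have hn1 : (1 : ℝ) ≤ |(n : ℝ)| := by exact_mod_cast Int.one_le_abs hn
    have h3 : 1 / (n : ℝ) ^ 2 ≤ 4 * (1 + |(n : ℝ)|) ^ (-2 : ℝ) := by
      rw [Real.rpow_neg (by positivity), Real.rpow_two, ← sq_abs (n : ℝ)]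
      rw [← div_eq_mul_inv, div_le_div_iff₀ (by positivity) (by positivity)]
      nlinarith
    calc tentCoeff h n * (1 + |(n : ℝ)|) ^ s
        ≤ 4 * (1 + |(n : ℝ)|) ^ (-2 : ℝ) * (1 + |(n : ℝ)|) ^ s := by
          gcongr
          exact (tentCoeff_le_one_div h hn).trans h3
      _ = 4 * (1 + |(n : ℝ)|) ^ (-(2 - s)) := by
          rw [mul_assoc, ← Real.rpow_add (by positivity)]
          congr 2
          ring
      _ ≤ _ := by simp [hn]

/-- Multiplication by a tent preserves Fourier decay: its coefficients convolve with those of `ν`,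
and `1 + |k| ≤ (1 + |l|) (1 + |k - l|)`. -/
lemma norm_circleFourierCoeff_localize_le [IsFiniteMeasure ν] (h0 : 0 < h) (h1 : h ≤ 1 / 2)
    {s D : ℝ} (hs0 : 0 ≤ s) (hs : s < 1)
    (hD : ∀ k, ‖circleFourierCoeff ν k‖ ≤ D * (1 + |(k : ℝ)|) ^ (-s)) (k : ℤ) :
    ‖circleFourierCoeff (localize ν h t) k‖ ≤ D * localizeConst h s * (1 + |(k : ℝ)|) ^ (-s) := by
  have hD0 : 0 ≤ D := by
    have := (norm_nonneg _).trans (hD 0)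
    simpa using this
  have H := hasSum_integral_of_summable_integral_norm (μ := ν)
    (F := fun (l : ℤ) (y : UnitAddCircle) =>
      (tentCoeff h l : ℂ) * fourier l (y - t) * fourier (-k) y)
    (fun l => (by fun_prop : Continuous fun y : UnitAddCircle =>
      (tentCoeff h l : ℂ) * fourier l (y - t) * fourier (-k) y).integrable_of_hasCompactSupport
        (HasCompactSupport.of_compactSpace _))
    (by
      simp only [norm_mul, norm_fourier_apply, Complex.norm_real, mul_one, integral_const,
        smul_eq_mul, Real.norm_of_nonneg (tentCoeff_nonneg h _)]
      exact (summable_tentCoeff h).mul_left _)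
  simp_rw [tsum_mul_right, (hasSum_tent h0 h1 _).tsum_eq] at H
  have e1 : circleFourierCoeff (localize ν h t) k
      = ∫ y, (tent h (y - t) : ℂ) * fourier (-k) y ∂ν := by
    rw [circleFourierCoeff, integral_localize]
    rfl
  have e2 : ∀ l : ℤ, ∫ y, (tentCoeff h l : ℂ) * fourier l (y - t) * fourier (-k) y ∂ν
      = (tentCoeff h l : ℂ) * fourier l (-t) * circleFourierCoeff ν (k - l) := by
    intro l
    rw [circleFourierCoeff, ← integral_const_mul]
    congr 1 with y
    rw [sub_eq_add_neg, fourier_apply_add, neg_sub, sub_eq_add_neg l, fourier_add]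
    ring
  simp_rw [e2] at H
  rw [← e1] at H
  rw [← H.tsum_eq]
  refine (tsum_of_norm_bounded
    ((summable_localizeConst (h := h) hs).mul_left (D * (1 + |(k : ℝ)|) ^ (-s))).hasSum
    fun l => ?_).trans_eq ?_
  · rw [norm_mul, norm_mul, norm_fourier_apply, mul_one, Complex.norm_real,
      Real.norm_of_nonneg (tentCoeff_nonneg h _)]
    have h3 : (1 + |((k - l : ℤ) : ℝ)|) ^ (-s) ≤ (1 + |(k : ℝ)|) ^ (-s) * (1 + |(l : ℝ)|) ^ s := by
      rw [Real.rpow_neg (by positivity), Real.rpow_neg (by positivity), inv_mul_eq_div,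
        ← one_div, div_le_div_iff₀ (by positivity) (by positivity), one_mul,
        ← Real.mul_rpow (by positivity) (by positivity)]
      apply Real.rpow_le_rpow (by positivity) _ hs0
      push_cast
      have := abs_add_le ((l : ℝ)) ((k : ℝ) - l)
      rw [add_sub_cancel] at this
      nlinarith [mul_nonneg (abs_nonneg (l : ℝ)) (abs_nonneg ((k : ℝ) - l))]
    calc tentCoeff h l * ‖circleFourierCoeff ν (k - l)‖
        ≤ tentCoeff h l * (D * ((1 + |(k : ℝ)|) ^ (-s) * (1 + |(l : ℝ)|) ^ s)) := by
          gcongr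
          · exact tentCoeff_nonneg h l
          · exact (hD _).trans (by gcongr)
      _ = _ := by ring
  · rw [tsum_mul_left, localizeConst]
    ring

end Localization

/-! ### From the interval to the circle and back -/

section Transfer

variable {μ : Measure ℝ}

lemma circleFourierCoeff_map (hμ : μ (Set.Icc 0 1)ᶜ = 0) (k : ℤ) :
    circleFourierCoeff (μ.map ((↑) : ℝ → UnitAddCircle)) k = measureFourierCoeff μ k := by
  have hm : Measurable ((↑) : ℝ → UnitAddCircle) := AddCircle.measurable_mk'
  rw [circleFourierCoeff, integral_map hm.aemeasurable
    (by fun_prop : Continuous fun y : UnitAddCircle => fourier (-k) y).aestronglyMeasurable,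
    measureFourierCoeff]
  have hae : ∀ᵐ x ∂μ, x ∈ Set.Icc (0 : ℝ) 1 := mem_ae_iff.2 hμ
  have hr := Measure.restrict_eq_self_of_ae_mem hae
  rw [hr]
  congr 1 with x
  rw [fourier_coe_apply]
  push_cast
  congr 1
  ring

lemma measureReal_map_closedBall_le [IsFiniteMeasure μ] (hμ : μ (Set.Icc 0 1)ᶜ = 0) {C α : ℝ}
    (hA : ∀ x ε : ℝ, 0 < ε → ε ≤ 1 → μ.real (Set.Icc x (x + ε)) ≤ C * ε ^ α)
    (x : UnitAddCircle) {ρ : ℝ} (h0 : 0 < ρ) (h1 : ρ ≤ 1 / 2) :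
    (μ.map ((↑) : ℝ → UnitAddCircle)).real (Metric.closedBall x ρ) ≤ 3 * C * (2 * ρ) ^ α := by
  have hm : Measurable ((↑) : ℝ → UnitAddCircle) := AddCircle.measurable_mk'
  obtain ⟨u, hu, rfl⟩ := AddCircle.coe_image_Icc_eq (1 : ℝ) 0 ▸ Set.mem_univ x
  rw [zero_add] at hu
  -- The arc has up to three lifts meeting `[0, 1]`, with centres `u - 1`, `u` and `u + 1`.
  let I : ℤ → Set ℝ := fun n => Set.Icc (u + n - ρ) (u + n - ρ + 2 * ρ)
  have hI : ∀ n, μ.real (I n) ≤ C * (2 * ρ) ^ α := fun n =>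
    hA _ _ (by linarith) (by linarith)
  rw [map_measureReal_apply hm Metric.isClosed_closedBall.measurableSet]
  have hsub : ((↑) : ℝ → UnitAddCircle) ⁻¹' Metric.closedBall (u : UnitAddCircle) ρ ⊆
      ((I (-1) ∪ I 0) ∪ I 1) ∪ (Set.Icc 0 1)ᶜ := by
    intro y hy
    by_cases hy01 : y ∈ Set.Icc (0 : ℝ) 1
    · left
      rw [Set.mem_preimage, Metric.mem_closedBall, dist_eq_norm, ← AddCircle.coe_sub,
        UnitAddCircle.norm_eq, abs_le] at hy
      obtain ⟨hu0, hu1⟩ := hu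
      obtain ⟨hy0, hy1⟩ := hy01
      have hn1 : round (y - u) < 2 := by
        have : ((round (y - u) : ℤ) : ℝ) < 2 := by linarith
        exact_mod_cast this
      have hn2 : -2 < round (y - u) := by
        have : (-2 : ℝ) < ((round (y - u) : ℤ) : ℝ) := by linarith
        exact_mod_cast this
      have hmem : y ∈ I (round (y - u)) := ⟨by linarith, by linarith⟩
      generalize round (y - u) = n at hn1 hn2 hmem
      have : n = -1 ∨ n = 0 ∨ n = 1 := by lia
      rcases this with rfl | rfl | rfl
      · exact .inl (.inl hmem)
      · exact .inl (.inr hmem)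
      · exact .inr hmem
    · exact .inr hy01
  calc _ ≤ μ.real (((I (-1) ∪ I 0) ∪ I 1) ∪ (Set.Icc 0 1)ᶜ) := measureReal_mono hsub
    _ ≤ μ.real (I (-1)) + μ.real (I 0) + μ.real (I 1) + μ.real (Set.Icc 0 1)ᶜ :=
        (measureReal_union_le _ _).trans (by
          gcongr
          exact (measureReal_union_le _ _).trans (by gcongr; exact measureReal_union_le _ _))
    _ ≤ _ := by
        have : μ.real (Set.Icc 0 1)ᶜ = 0 := by simp [Measure.real, hμ]
        linarith [hI (-1), hI 0, hI 1]

/-- A progression in the circle lying in a short arc that avoids `0` does not wrap around, so it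
lifts to a progression in `ℝ`. -/
lemma exists_real_progression {E : Set ℝ} (hE : E ⊆ Set.Icc 0 1) {h : ℝ} (hh : h < 1 / 4)
    {t : UnitAddCircle} (ht : h < ‖t‖) {x r : UnitAddCircle} (hr : r ≠ 0)
    (h1 : x ∈ ((↑) : ℝ → UnitAddCircle) '' E ∩ Metric.closedBall t h)
    (h2 : x + r ∈ ((↑) : ℝ → UnitAddCircle) '' E ∩ Metric.closedBall t h)
    (h3 : x + r + r ∈ ((↑) : ℝ → UnitAddCircle) '' E ∩ Metric.closedBall t h) :
    ∃ x r : ℝ, r ≠ 0 ∧ x ∈ E ∧ x + r ∈ E ∧ x + 2 * r ∈ E := by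
  obtain ⟨u, hu, rfl⟩ := AddCircle.coe_image_Icc_eq (1 : ℝ) 0 ▸ Set.mem_univ t
  rw [zero_add] at hu
  have hu0 : h < u := by
    rcases le_total u (1 / 2) with H | H
    · rwa [norm_coe_of_le_half hu.1 H] at ht
    · linarith
  have hu1 : u < 1 - h := by
    rcases le_total u (1 / 2) with H | H
    · linarith
    · rw [norm_coe_of_half_le H hu.2] at ht
      linarith
  have key : ∀ a ∈ E, (a : UnitAddCircle) ∈ Metric.closedBall (u : UnitAddCircle) h →
      |a - u| ≤ h := by
    intro a ha hau
    obtain ⟨ha0, ha1⟩ := hE ha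
    rw [Metric.mem_closedBall, dist_eq_norm, ← AddCircle.coe_sub, UnitAddCircle.norm_eq] at hau
    have hau' := abs_le.1 hau
    have hn1 : round (a - u) < 1 := by
      have : ((round (a - u) : ℤ) : ℝ) < 1 := by linarith
      exact_mod_cast this
    have hn2 : -1 < round (a - u) := by
      have : (-1 : ℝ) < ((round (a - u) : ℤ) : ℝ) := by linarith
      exact_mod_cast this
    have : round (a - u) = 0 := by lia
    simpa [this] using hau
  obtain ⟨⟨a, ha, rfl⟩, hat⟩ := h1
  obtain ⟨⟨b, hb, hbx⟩, hbt⟩ := h2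
  obtain ⟨⟨c, hc, hcx⟩, hct⟩ := h3
  rw [← hbx] at hbt
  rw [← hcx] at hct
  have ka := abs_le.1 (key a ha hat)
  have kb := abs_le.1 (key b hb hbt)
  have kc := abs_le.1 (key c hc hct)
  -- `a + c - 2b` is an integer of absolute value at most `4h < 1`.
  have hz : ((a + c - 2 * b : ℝ) : UnitAddCircle) = 0 := by
    rw [two_mul, AddCircle.coe_sub, AddCircle.coe_add, AddCircle.coe_add, hbx, hcx]
    abel
  obtain ⟨n, hn⟩ := (AddCircle.coe_eq_zero_iff (1 : ℝ)).1 hz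
  rw [zsmul_eq_mul, mul_one] at hn
  have hn1 : n < 1 := by
    have : (n : ℝ) < 1 := by linarith
    exact_mod_cast this
  have hn2 : -1 < n := by
    have : (-1 : ℝ) < n := by linarith
    exact_mod_cast this
  have hn0 : n = 0 := by lia
  rw [hn0, Int.cast_zero] at hn
  refine ⟨a, b - a, fun hab => hr ?_, ha, by simpa using hb, ?_⟩
  · have : b = a := by linarith
    rw [this] at hbx
    simpa using hbx.symm
  · have : a + 2 * (b - a) = c := by linarith
    rwa [this]

end Transfer

/-- With `x = 1 - α`, the error in passing from the scale `exp(-1/x)` to finer scales tends to `0`: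
exponential decay in `1/x` beats polynomial growth. -/
lemma tendsto_small_constant (K A B γ : ℝ) (hγ : 0 < γ) :
    Tendsto (fun x : ℝ => K * (1 + A * x ^ (-B)) ^ 3 * Real.exp (-1 / x) ^ γ) (𝓝[>] 0) (𝓝 0) := by
  have h1 := tendsto_rpow_mul_exp_neg_mul_atTop_nhds_zero 0 (γ / 3) (by positivity)
  have h2 := (tendsto_rpow_mul_exp_neg_mul_atTop_nhds_zero B (γ / 3) (by positivity)).const_mul A
  have h3 := (((h1.add h2).pow 3).const_mul K).comp tendsto_inv_nhdsGT_zero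
  simp only [mul_zero, add_zero, ne_eq, OfNat.ofNat_ne_zero, not_false_eq_true, zero_pow] at h3
  refine h3.congr' ?_
  filter_upwards [self_mem_nhdsWithin] with x hx
  have hx : 0 < x := hx
  have e1 : (x⁻¹) ^ B = x ^ (-B) := by rw [Real.inv_rpow hx.le, Real.rpow_neg hx.le]
  have e2 : Real.exp (-1 / x) ^ γ = Real.exp (-(γ / 3) * x⁻¹) ^ 3 := by
    rw [← Real.exp_mul, ← Real.exp_nat_mul]
    congr 1
    push_cast
    field_simp
  simp only [Function.comp_apply, Real.rpow_zero]
  rw [e1, e2]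
  ring

theorem theorem1 (C₁ C₂ B β : ℝ) (hβ : 2 / 3 < β) (hβ' : β ≤ 1) :
    ∃ ε₀ : ℝ, 0 < ε₀ ∧
      ∀ (α : ℝ), 0 < α → α < 1 → 1 - ε₀ < α →
      ∀ (E : Set ℝ), IsClosed E → E ⊆ Set.Icc 0 1 →
      ∀ (μ : Measure ℝ), IsProbabilityMeasure μ → μ Eᶜ = 0 →
        (∀ x ε : ℝ, 0 < ε → ε ≤ 1 → μ.real (Set.Icc x (x + ε)) ≤ C₁ * ε ^ α) →
        (∀ k : ℤ, k ≠ 0 →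
          ‖measureFourierCoeff μ k‖ ≤ C₂ * (1 - α) ^ (-B) * |(k : ℝ)| ^ (-(β / 2))) →
        ∃ x r : ℝ, r ≠ 0 ∧ x ∈ E ∧ x + r ∈ E ∧ x + 2 * r ∈ E := by
  set C : ℝ := |C₁| + 1 with hC
  have hC1 : 1 ≤ C := by linarith [abs_nonneg C₁]
  have hCC : C₁ ≤ C := by linarith [le_abs_self C₁]
  -- The width of the localizing tent: small enough that the arc of radius `2 h₁` around `0` has mass
  -- at most `1 / 2` as soon as `α ≥ 1 / 2`.
  set h₁ : ℝ := 1 / (256 * C ^ 2) with hh₁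
  have h₁0 : 0 < h₁ := by positivity
  have h₁1 : h₁ ≤ 1 / 256 := by
    rw [hh₁]
    apply one_div_le_one_div_of_le (by norm_num)
    nlinarith
  set γ : ℝ := (3 * β / 2 - 1) / 2 with hγ
  have hγ0 : 0 < γ := by linarith
  obtain ⟨c, hc0, hc⟩ := exists_pos_le_progressionForm_stepWeight
    (M := 6 * C * Real.exp 1) (m := h₁ ^ 2 * (1 / 2)) (by positivity) (by positivity)
  set L := localizeConst h₁ (β / 2) with hL
  have hlim := tendsto_small_constant (24 * (4 * Real.pi) ^ γ * decaySum γ * L ^ 3) (2 * |C₂|) B γ hγ0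
  obtain ⟨u, hu0, hu⟩ := mem_nhdsGT_iff_exists_Ioo_subset.1 (hlim.eventually (gt_mem_nhds hc0))
  have hu0 : 0 < u := hu0
  refine ⟨min u (1 / 2), by positivity, fun α hα0 hα1 hα E hE hE01 μ hμ hμE hA hB => ?_⟩
  set x := 1 - α with hx
  have hx0 : 0 < x := by linarith
  have hxu : x < u := by linarith [min_le_left u (1 / 2)]
  have hx2 : x < 1 / 2 := by linarith [min_le_right u (1 / 2)]
  have hsmall := hu ⟨hx0, hxu⟩
  -- At this scale `h ^ (α - 1) = e`, whatever `α` is.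
  set h := Real.exp (-1 / x) with hh
  have h0 : 0 < h := Real.exp_pos _
  have h1 : h ≤ 1 / 2 := by
    have : -1 / x ≤ -1 := by rw [div_le_iff₀ hx0]; linarith
    refine (Real.exp_le_exp.2 this).trans ?_
    rw [Real.exp_neg, ← one_div]
    apply one_div_le_one_div_of_le (by norm_num)
    linarith [Real.add_one_le_exp 1]
  have hA' : ∀ x ε : ℝ, 0 < ε → ε ≤ 1 → μ.real (Set.Icc x (x + ε)) ≤ C * ε ^ α :=
    fun x ε a b => (hA x ε a b).trans (by gcongr)
  have hμ01 : μ (Set.Icc 0 1)ᶜ = 0 :=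
    measure_mono_null (Set.compl_subset_compl.2 hE01) hμE
  have hm : Measurable ((↑) : ℝ → UnitAddCircle) := AddCircle.measurable_mk'
  set ν := μ.map ((↑) : ℝ → UnitAddCircle) with hν
  have hνp : IsProbabilityMeasure ν := Measure.isProbabilityMeasure_map hm.aemeasurable
  have hball := fun x (ρ : ℝ) => measureReal_map_closedBall_le hμ01 hA' x (ρ := ρ)
  set S : Set UnitAddCircle := Metric.closedBall 0 (2 * h₁)
  have hSm : MeasurableSet S := Metric.isClosed_closedBall.measurableSet
  have hS : ν.real S ≤ 1 / 2 := by
    refine (hball 0 (2 * h₁) (by linarith) (by linarith)).trans ?_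
    have e1 : (2 * (2 * h₁)) ^ α ≤ (2 * (2 * h₁)) ^ (1 / 2 : ℝ) :=
      Real.rpow_le_rpow_of_exponent_ge (by positivity) (by linarith) (by linarith)
    have e2 : (2 * (2 * h₁)) ^ (1 / 2 : ℝ) = 1 / (8 * C) := by
      rw [← Real.sqrt_eq_rpow, Real.sqrt_eq_iff_mul_self_eq (by positivity) (by positivity), hh₁]
      field_simp
      norm_num
    calc 3 * C * (2 * (2 * h₁)) ^ α ≤ 3 * C * (1 / (8 * C)) := by
          rw [← e2]; gcongr
      _ = 3 / 8 := by field_simp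
      _ ≤ 1 / 2 := by norm_num
  have hSc : 1 / 2 ≤ ν.real Sᶜ := by
    rw [probReal_compl_eq_one_sub hSm]; linarith
  -- Averaging over the mass outside `S` forces the chosen centre `t` away from `0`.
  obtain ⟨t, ht⟩ := exists_le_integral_tent_sub (ν.restrict Sᶜ) h₁0 (by linarith)
  rw [measureReal_restrict_apply_univ] at ht
  have ht' : h₁ ^ 2 * (1 / 2) ≤ ∫ y in Sᶜ, tent h₁ (y - t) ∂ν := le_trans (by gcongr) ht
  have htn : h₁ < ‖t‖ := by
    by_contra! htn
    have : ∫ y in Sᶜ, tent h₁ (y - t) ∂ν = 0 := by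
      refine setIntegral_eq_zero_of_forall_eq_zero fun y hy => tent_eq_zero ?_
      rw [Set.mem_compl_iff, Metric.mem_closedBall, dist_zero_right] at hy
      linarith [norm_sub_norm_le y t]
    have : 0 < h₁ ^ 2 * (1 / 2) := by positivity
    linarith
  set σ := localize ν h₁ t with hσ
  have hσν : σ ≤ ν := localize_le h₁0.le (by linarith)
  have hσm : h₁ ^ 2 * (1 / 2) ≤ σ.real Set.univ := by
    rw [hσ, measureReal_univ_localize]
    exact ht'.trans (setIntegral_le_integral integrable_tent_sub
      (.of_forall fun y => tent_nonneg _ _))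
  set F := ((↑) : ℝ → UnitAddCircle) '' E ∩ Metric.closedBall t h₁ with hF
  have hEc : IsClosed (((↑) : ℝ → UnitAddCircle) '' E) :=
    ((isCompact_Icc.of_isClosed_subset hE hE01).image (AddCircle.continuous_mk' 1)).isClosed
  have hFc : IsClosed F := hEc.inter Metric.isClosed_closedBall
  have hσF : σ Fᶜ = 0 := by
    rw [hF, Set.compl_inter]
    refine measure_union_null (nonpos_iff_eq_zero.1 ((hσν _).trans ?_)) localize_compl_closedBall
    rw [hν, Measure.map_apply hm hEc.measurableSet.compl]
    have hsub : ((↑) : ℝ → UnitAddCircle) ⁻¹' (((↑) : ℝ → UnitAddCircle) '' E)ᶜ ⊆ Eᶜ :=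
      fun y hy hyE => hy (Set.mem_image_of_mem _ hyE)
    exact (measure_mono hsub).trans_eq hμE
  have hM : ∀ x, tentSmoothing σ h x ≤ 6 * C * Real.exp 1 := by
    intro z
    have e0 : h ^ α = h * Real.exp 1 := by
      rw [hh, ← Real.exp_mul, ← Real.exp_add]
      congr 1
      rw [show α = 1 - x by rw [hx]; ring]
      field_simp
      ring
    have e1 : σ.real (Metric.closedBall z h) ≤ 6 * C * (h * Real.exp 1) := by
      calc σ.real (Metric.closedBall z h) ≤ ν.real (Metric.closedBall z h) :=
            ENNReal.toReal_mono (measure_ne_top _ _) (hσν _)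
        _ ≤ 3 * C * (2 * h) ^ α := hball z h h0 h1
        _ = 3 * C * (2 ^ α * (h * Real.exp 1)) := by
            rw [Real.mul_rpow (by norm_num) h0.le, e0]
        _ ≤ 3 * C * (2 ^ (1 : ℝ) * (h * Real.exp 1)) := by
            gcongr
            norm_num
        _ = _ := by rw [Real.rpow_one]; ring
    calc tentSmoothing σ h z ≤ h⁻¹ * σ.real (Metric.closedBall z h) := tentSmoothing_le h0 z
      _ ≤ h⁻¹ * (6 * C * (h * Real.exp 1)) := by gcongr
      _ = _ := by field_simp
  have hDν : ∀ k, ‖circleFourierCoeff ν k‖ ≤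
      (1 + 2 * |C₂| * x ^ (-B)) * (1 + |(k : ℝ)|) ^ (-(β / 2)) := by
    intro k
    have hxB : 0 ≤ x ^ (-B) := by positivity
    by_cases hk : k = 0
    · have := norm_circleFourierCoeff_le (ν := ν) k
      rw [probReal_univ] at this
      refine this.trans ?_
      simp only [hk, Int.cast_zero, abs_zero, add_zero, Real.one_rpow, mul_one]
      have : 0 ≤ 2 * |C₂| * x ^ (-B) := by positivity
      linarith
    · rw [hν, circleFourierCoeff_map hμ01]
      have hk1 : (1 : ℝ) ≤ |(k : ℝ)| := by exact_mod_cast Int.one_le_abs hk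
      have e1 := rpow_neg_le_of_le_two_mul (s := β / 2) (by linarith) (by linarith)
        (a := 1 + |(k : ℝ)|) (b := |(k : ℝ)|) (by positivity) (by linarith)
      have e2 : 0 ≤ (1 + |(k : ℝ)|) ^ (-(β / 2)) := by positivity
      calc _ ≤ C₂ * x ^ (-B) * |(k : ℝ)| ^ (-(β / 2)) := hB k hk
        _ ≤ |C₂| * x ^ (-B) * (2 * (1 + |(k : ℝ)|) ^ (-(β / 2))) := by
            gcongr
            exact le_abs_self _
        _ ≤ _ := by linarith
  have hDσ := norm_circleFourierCoeff_localize_le (ν := ν) (t := t) h₁0 (by linarith)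
    (by linarith : 0 ≤ β / 2) (by linarith) hDν
  have hT := hc (tentSmoothing σ h) (continuous_tentSmoothing h0.le) (tentSmoothing_nonneg σ h) hM
    (by rwa [integral_tentSmoothing h0 h1])
  obtain ⟨y, r, hr, hy1, hy2, hy3⟩ := exists_progression_of_fourier_decay hβ hβ' hγ hDσ hFc hσF
    h0 h1 hT (by
      refine lt_of_eq_of_lt ?_ hsmall
      simp only [hL]
      ring)
  exact exists_real_progression hE01 (by linarith) htn hr hy1 hy2 hy3
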